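/- Let $K$ be a non-Archimedean local field with canonical absolute value $|\cdot|$ (the factor by which multiplication scales additive Haar measure), ring of integers $O$, maximal ideal $P=\beta O$ with uniformizer $\beta$, and residue field $O/P$ with $q$ elements. For $r\in\mathbf Z$ put $B_r=\beta^{-r}O$. Let $S\ni 0$ be a complete set of representatives of $O/P$ in $O$, and let $\chi$ be a continuous unitary character of $(K,+)$ of rank zero, i.e. $0$ is the largest integer $r$ with $\chi|_{B_r}\equiv 1$. Let $\alpha>0$, $t>0$, let $n\ge 1$ be an integer, and let $v:K\to[0,\infty)$ be continuous with $v(x)\to\infty$ as $|x|\to\infty$. Let $X_n=\{\sum_{i=-n}^{n-1}a_i\beta^i : a_i\in S\}$, the canonical set of representatives of $B_n/B_{-n}$, with the group structure of $B_n/B_{-n}$ and the Haar measure $\mu_n$ giving mass $q^{-n}$ to each point. On $L^2(X_n)=L^2(X_n,\mu_n)$ let $$(\mathcal F_nf)(x)=q^{-n}\sum_{y\in X_n}f(y)\chi(-xy),\qquad (\mathcal F_n^{-1}f)(x)=q^{-n}\sum_{y\in X_n}f(y)\chi(xy),$$ $(Q_nf)(x)=|x|f(x)$, $P_n=\mathcal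 F_n^{-1}Q_n\mathcal F_n$ (a positive operator), $(V_nf)(x)=v_n(x)f(x)$ with $v_n=v|_{X_n}$, and $H_n=P_n^\alpha+V_n$. For $s\ge 0$ put $p_{s,n}=\mathcal F_n^{-1}(e^{-s|\cdot|^\alpha})$, that is, $p_{s,n}(x)=q^{-n}\sum_{\xi\in X_n}e^{-s|\xi|^\alpha}\chi(x\xi)$, $x\in X_n$. Let $D[0,t]$ be the space of functions $\omega:[0,t]\to K$ which are right continuous on $[0,t)$, have left limits on $(0,t]$, and are left continuous at $t$, with the $\sigma$-algebra generated by the evaluations $\omega\mapsto\omega(s)$. Then for each $a\in X_n$ there is a unique probability measure $\mathbf P^n_a$ on $D[0,t]$ such that $$\mathbf P^n_a(\omega(t_i)\in J_i,\ 1\le i\le N)=\sum_{b_i\in J_i\cap X_n,\ 1\le i\le N}p_{t_1,n}(b_1-a)\,p_{t_2-t_1,n}(b_2-b_1)\cdots p_{t_N-t_{N-1},n}(b_N-b_{N-1})\,q^{-nN}$$ for all $0\le t_1<\dots<t_N\le t$ and all Borel sets $J_1,\dots,J_N\subset K$. For $a,b\in X_n$ let $\mathbf P^n_{a,b,t}(A)=\mathbf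 P^n_a(A\cap(\omega(t)=b))/\mathbf P^n_a(\omega(t)=b)$. Then $e^{-tH_n}$ is an integral operator: for all $f\in L^2(X_n)$ and $x\in X_n$, $$(e^{-tH_n}f)(x)=\int_{X_n}K^n_t(x,y)f(y)\,d\mu_n(y)=q^{-n}\sum_{y\in X_n}K^n_t(x,y)f(y),$$ where $$K^n_t(x,y)=\int_{D[0,t]}\exp\Big(-\int_0^tv_n(\omega(s))\,ds\Big)\,d\mathbf P^n_{x,y,t}(\omega)\cdot p_{t,n}(y-x),\qquad x,y\in X_n.$$ Here, off $X_n$, $v_n$ is read as $\sum_{y\in X_n}v(y)\mathbf 1_{y+B_{-n}}$. -/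

import Mathlib

open MeasureTheory ValuativeRel Filter Topology

noncomputable section

namespace FiniteFK

section LocalField

variable {K : Type*} [Field K] [ValuativeRel K] [TopologicalSpace K]
  [IsNonarchimedeanLocalField K]

/-- The canonical absolute value of a local field, induced by the Haar measure: `|0| = 0` and, for
`x ≠ 0`, `|x|` is the factor by which multiplication by `x` scales every additive Haar measure. -/
def canonicalAbs (x : K) : ℝ :=
  open Classical in
  if hx : x = 0 then 0 else (distribHaarChar K (Units.mk0 x hx) : ℝ)

variable (K) in
/-- The number `q` of elements of the residue field `O / P`. -/
def residueCard : ℕ := Nat.card (IsLocalRing.ResidueField (valuation K).integer)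

/-- `β` is a uniformizer: `P = β O`, where `O = {x | v x ≤ 1}` and `P = {x | v x < 1}`. -/
def IsUniformizer (β : K) : Prop :=
  ∀ x : K, valuation K x < 1 ↔ ∃ y : K, valuation K y ≤ 1 ∧ x = β * y

/-- The ball `B_r = β ^ (-r) O` of radius `q ^ r`, for an integer `r`. -/
def ball (β : K) (r : ℤ) : Set K := {x | valuation K (β ^ r * x) ≤ 1}

/-- The character `χ` has rank zero: the largest integer `r` with `χ = 1` on `B_r` is `0`. -/
def HasRankZero (β : K) (χ : AddChar K Circle) : Prop :=
  IsGreatest {r : ℤ | ∀ x ∈ ball β r, χ x = 1} 0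

/-- `S` is a complete set of representatives of the residue classes in `O / P`, in which the zero
class is represented by `0`. -/
structure IsResidueSystem (S : Finset K) : Prop where
  subset_integers : ∀ s ∈ S, valuation K s ≤ 1
  existsUnique_rep : ∀ x : K, valuation K x ≤ 1 → ∃! s, s ∈ S ∧ valuation K (x - s) < 1
  zero_mem : (0 : K) ∈ S

/-- The canonical set `X_n` of representatives of `G_n = B_n / B_{-n}`: all the sums
`a_{-n} β ^ (-n) + ⋯ + a_{n-1} β ^ (n-1)` with digits in `S`. -/
def grid (β : K) (S : Finset K) (n : ℕ) : Finset K :=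
  open Classical in
  (Fintype.piFinset fun _ : Fin (2 * n) => S).image
    fun a => ∑ i : Fin (2 * n), a i * β ^ ((i : ℤ) - (n : ℤ))

/-- The Hilbert space `L²(X_n)` of all complex functions on `X_n`. All the points of `X_n` have the
same mass `q ^ (-n)`, so leaving this factor out of the inner product changes neither adjoints nor
positivity of operators, nor their functions. -/
abbrev GridL2 (β : K) (S : Finset K) (n : ℕ) : Type _ := EuclideanSpace ℂ (grid β S n)

/-- The operator on `L²(X_n)` given by a matrix: `(A f)(x) = ∑ y, A x y * f y`. -/
def matrixOp (β : K) (S : Finset K) (n : ℕ) (A : Matrix (grid β S n) (grid β S n) ℂ) :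
    GridL2 β S n →L[ℂ] GridL2 β S n :=
  open Classical in Matrix.toEuclideanCLM (n := grid β S n) (𝕜 := ℂ) A

/-- Multiplication by (the restriction to `X_n` of) a real function on `K`. -/
def mulOp (β : K) (S : Finset K) (n : ℕ) (g : K → ℝ) : GridL2 β S n →L[ℂ] GridL2 β S n :=
  open Classical in matrixOp β S n (Matrix.diagonal fun x => ((g x : ℝ) : ℂ))

/-- The finite Fourier transform, `(F_n f)(x) = q ^ (-n) ∑ y, f y * χ (-x y)`. -/
def fourierOp (β : K) (S : Finset K) (n : ℕ) (χ : AddChar K Circle) :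
    GridL2 β S n →L[ℂ] GridL2 β S n :=
  matrixOp β S n (Matrix.of fun x y =>
    ((residueCard K : ℂ) ^ n)⁻¹ * (χ (-((x : K) * (y : K))) : ℂ))

/-- The inverse finite Fourier transform, `(F_n⁻¹ f)(x) = q ^ (-n) ∑ y, f y * χ (x y)`. -/
def fourierInvOp (β : K) (S : Finset K) (n : ℕ) (χ : AddChar K Circle) :
    GridL2 β S n →L[ℂ] GridL2 β S n :=
  matrixOp β S n (Matrix.of fun x y =>
    ((residueCard K : ℂ) ^ n)⁻¹ * (χ ((x : K) * (y : K)) : ℂ))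

/-- The finite momentum operator `P_n = F_n⁻¹ Q_n F_n`, where `(Q_n f)(x) = |x| f(x)`. -/
def momentumOp (β : K) (S : Finset K) (n : ℕ) (χ : AddChar K Circle) :
    GridL2 β S n →L[ℂ] GridL2 β S n :=
  fourierInvOp β S n χ * mulOp β S n canonicalAbs * fourierOp β S n χ

/-- The finite Hamiltonian `H_n = P_n ^ α + V_n`; the power of the positive operator `P_n` is the
one of the continuous functional calculus. -/
def hamiltonian (β : K) (S : Finset K) (n : ℕ) (χ : AddChar K Circle) (α : ℝ) (v : K → ℝ) :
    GridL2 β S n →L[ℂ] GridL2 β S n :=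
  momentumOp β S n χ ^ α + mulOp β S n v

/-- The density `p_{s,n}(x) = (F_n⁻¹ e^{-s|·|^α})(x) = q ^ (-n) ∑ ξ, e^{-s|ξ|^α} χ (x ξ)`, the sum
being over `ξ ∈ X_n`. The formula makes sense for every `x ∈ K` and depends only on the class of
`x` modulo `B_{-n}` (see `density_add`); hence `density (y - x)`, with the difference taken in `K`,
is the value of `p_{s,n}` at the difference of `x, y ∈ X_n` in the group `X_n ≃ B_n / B_{-n}`. -/
def density (β : K) (S : Finset K) (n : ℕ) (χ : AddChar K Circle) (α s : ℝ) (x : K) : ℂ :=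
  ((residueCard K : ℂ) ^ n)⁻¹ *
    ∑ ξ ∈ grid β S n, (Real.exp (-s * canonicalAbs ξ ^ α) : ℂ) * (χ (x * ξ) : ℂ)

/-- The finite version of a function on `K`: `E_n g = ∑ y, g y * 1_{y + B_{-n}}`, over `y ∈ X_n`. -/
def discretize (β : K) (S : Finset K) (n : ℕ) (g : K → ℝ) (z : K) : ℝ :=
  ∑ y ∈ grid β S n, {w : K | w - y ∈ ball β (-(n : ℤ))}.indicator (fun _ => g y) z

theorem density_add (β : K) (hβ : IsUniformizer β) (S : Finset K) (hS : IsResidueSystem S)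
    (n : ℕ) (χ : AddChar K Circle) (hχ : HasRankZero β χ) (α s : ℝ) (x h : K)
    (hh : h ∈ ball β (-(n : ℤ))) :
    density β S n χ α s (x + h) = density β S n χ α s x := by
  classical
  have hβ1 : valuation K β ≤ 1 := ((hβ β).2 ⟨1, by simp, by simp⟩).le
  have hβ0 : β ≠ 0 := by
    rintro rfl
    obtain ⟨r, hr, hr'⟩ := Valuation.IsNontrivial.exists_lt_one (v := valuation K)
    obtain ⟨y, -, hy⟩ := (hβ r).1 hr'
    exact hr (by simp [hy])
  unfold density
  congr 1
  refine Finset.sum_congr rfl fun ξ hξ => ?_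
  obtain ⟨a, ha, rfl⟩ := Finset.mem_image.1 hξ
  have ha' := Fintype.mem_piFinset.1 ha
  congr 2
  rw [add_mul, AddChar.map_add_eq_mul]
  have : χ (h * ∑ i : Fin (2 * n), a i * β ^ ((i : ℤ) - (n : ℤ))) = 1 := by
    apply hχ.1
    have e : β ^ (0 : ℤ) * (h * ∑ i : Fin (2 * n), a i * β ^ ((i : ℤ) - (n : ℤ)))
        = (β ^ (-(n : ℤ)) * h) * ∑ i : Fin (2 * n), a i * β ^ (i : ℕ) := by
      simp only [zpow_zero, one_mul, Finset.mul_sum]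
      refine Finset.sum_congr rfl fun i _ => ?_
      rw [sub_eq_add_neg, zpow_add₀ hβ0, zpow_natCast]
      ring
    change valuation K _ ≤ 1
    rw [e, map_mul]
    refine mul_le_one' hh ?_
    refine Valuation.map_sum_le _ fun i _ => ?_
    rw [map_mul, map_pow]
    exact mul_le_one' (hS.subset_integers _ (ha' i)) (pow_le_one' hβ1 _)
  rw [this, mul_one]

end LocalField

section Paths

/-- The space `D[0,t]`: functions on `[0,t]` that are right continuous on `[0,t)`, have left limits
on `(0,t]`, and are left continuous at `t`. As a set of functions it carries the σ-algebra generated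
by the evaluations `ω ↦ ω s`, `s ∈ [0,t]`. -/
def skorokhod (K : Type*) [TopologicalSpace K] (t : ℝ) : Set (Set.Icc (0 : ℝ) t → K) :=
  {ω | (∀ s : Set.Icc (0 : ℝ) t, (s : ℝ) < t → Tendsto ω (𝓝[>] s) (𝓝 (ω s))) ∧
    (∀ s : Set.Icc (0 : ℝ) t, 0 < (s : ℝ) → ∃ l : K, Tendsto ω (𝓝[<] s) (𝓝 l)) ∧
    (∀ s : Set.Icc (0 : ℝ) t, (s : ℝ) = t → Tendsto ω (𝓝[<] s) (𝓝 (ω s)))}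

variable {K : Type*} [Field K] [ValuativeRel K] [TopologicalSpace K]
  [IsNonarchimedeanLocalField K] [MeasurableSpace K]

/-- `P` is a probability measure on `D[0,t]` with the finite dimensional distributions
`P (ω t_1 ∈ J_1, …, ω t_N ∈ J_N) =
  ∑ p_{t_1,n}(b_1 - a) p_{t_2-t_1,n}(b_2 - b_1) ⋯ p_{t_N-t_{N-1},n}(b_N - b_{N-1}) q ^ (-nN)`,
the sum being over all `b_i ∈ J_i ∩ X_n`. -/
structure IsPathLaw (β : K) (S : Finset K) (n : ℕ) (χ : AddChar K Circle) (α t : ℝ) (a : K)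
    (P : Measure (skorokhod K t)) : Prop where
  isProbabilityMeasure : IsProbabilityMeasure P
  cylinder : ∀ (N : ℕ) (τ : Fin N → Set.Icc (0 : ℝ) t), StrictMono τ →
    ∀ J : Fin N → Set K, (∀ i, MeasurableSet (J i)) →
      ((P.real {ω | ∀ i, ω.1 (τ i) ∈ J i} : ℝ) : ℂ) =
        open Classical in
        ∑ b ∈ Fintype.piFinset (fun i => (grid β S n).filter (· ∈ J i)),
          (∏ i : Fin N, density β S n χ α
            ((τ i : ℝ) - (Fin.cons 0 (fun j => (τ j : ℝ)) : Fin (N + 1) → ℝ) i.castSucc)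
            (b i - (Fin.cons a b : Fin (N + 1) → K) i.castSucc)) *
          ((residueCard K : ℂ) ^ (n * N))⁻¹

/-- The measure `P^n_a` on `D[0,t]` (with value `0` if there were no measure as required). -/
def pathMeasure (β : K) (S : Finset K) (n : ℕ) (χ : AddChar K Circle) (α t : ℝ) (a : K) :
    Measure (skorokhod K t) :=
  open Classical in
  if h : ∃ P : Measure (skorokhod K t), IsPathLaw β S n χ α t a P then h.choose else 0

/-- The conditioned measure `P^n_{a,b,t}(A) = P^n_a(A ∩ (ω t = b)) / P^n_a(ω t = b)`. -/
def bridgeMeasure (β : K) (S : Finset K) (n : ℕ) (χ : AddChar K Circle) (α t : ℝ) (a b : K) :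
    Measure (skorokhod K t) :=
  ProbabilityTheory.cond (pathMeasure β S n χ α t a)
    {ω | ∀ s : Set.Icc (0 : ℝ) t, (s : ℝ) = t → ω.1 s = b}

/-- The kernel `K^n_t(x,y) = ∫ exp (-∫₀ᵗ v_n(ω s) ds) dP^n_{x,y,t}(ω) · p_{t,n}(y - x)`. -/
def kernel (β : K) (S : Finset K) (n : ℕ) (χ : AddChar K Circle) (α t : ℝ) (v : K → ℝ)
    (x y : K) : ℂ :=
  ((∫ ω, Real.exp (-∫ s : Set.Icc (0 : ℝ) t, discretize β S n v (ω.1 s) ∂(volume.comap Subtype.val))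
      ∂(bridgeMeasure β S n χ α t x y) : ℝ) : ℂ) * density β S n χ α t (y - x)

/-- The Haar measure `μ_n` on `X_n`, each point having mass `q ^ (-n)`. -/
def gridMeasure (β : K) (S : Finset K) (n : ℕ) : Measure (grid β S n) :=
  ((residueCard K : ENNReal) ^ n)⁻¹ • Measure.count

end Paths

end FiniteFK

end

open MeasureTheory ValuativeRel Filter Topology

noncomputable section

set_option linter.unusedSectionVars false

namespace FiniteFK

/-! ### Balls, digit expansions and the canonical absolute value -/

section Arithmetic

variable {K : Type*} [Field K] [ValuativeRel K] [TopologicalSpace K]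
  [IsNonarchimedeanLocalField K] {β : K} {S : Finset K} {n : ℕ}

/-! The path measure is the law of a compound Poisson process on the finite group `B_n / B_{-n}`.
Let `C` be the sum of all `|ξ|^α`, `ξ ∈ X_n`, and give the jump `z` the rate `w(z) = q^{-2n} ∑ ξ, (C
- |ξ|^α) χ(zξ)`. Fourier inversion gives `∑ z, w(z) χ(-ηz) = C - |η|^α`, so the increments over a
time `s` should have the Fourier transform `e^{-s|η|^α}`, that of `p_{s,n}`.

The essential point is `w ≥ 0`. The weight `C - |ξ|^α` is the integral over `ρ ∈ [0,C]` of the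
indicator of `|ξ|^α ≤ ρ`. By the ultrametric inequality each of these level sets is closed under the
addition of the group, so the sum of a character over it is either `0` or its cardinality
(`sum_char_level_nonneg`, `jumpWeight_spec`).

The process is built by hand: for each number `k` of jumps, `k` independent pairs (time, jump) are
integrated against the product of the intensities, and the results are summed with the weights
`e^{-Ct} / k!`. Cylinder events are expanded in characters of the increments. Each character is a
product over the jumps, so the integral is a `k`-th power, and summing over `k` gives the
exponential that the densities require (`poissonLaw_cylinder`). Paths are step functions, hence lie
in `D[0,t]`; uniqueness holds because the cylinders form a generating π-system.

The kernel formula then follows the classical route. `F_n` is unitary and diagonalises `P_n`, so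
`e^{-sP_n^α}` has the matrix `q^{-n} p_{s,n}(x - y)`. In the Trotter product for `e^{-tH_n}` the
`m`-th power is a sum over chains of points, that is, the expectation of `exp(-Riemann sum of
v_n(ω)) f(ω(t))` (`integral_trotter`). Right continuity of paths and dominated convergence yield the
Feynman–Kac formula (`exp_hamiltonian_eq_integral`). Splitting according to the endpoint `ω(t) = y`,
whose probability is `q^{-n} p_{t,n}(y - x)`, turns it into the bridge kernel
(`kernel_eq_setIntegral`). -/

theorem IsUniformizer.valuation_lt_one (hβ : IsUniformizer β) : valuation K β < 1 :=
  (hβ β).2 ⟨1, by simp, by simp⟩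

theorem IsUniformizer.ne_zero (hβ : IsUniformizer β) : β ≠ 0 := by
  rintro rfl
  obtain ⟨r, hr, hr'⟩ := Valuation.IsNontrivial.exists_lt_one (v := valuation K)
  obtain ⟨y, -, hy⟩ := (hβ r).1 hr'
  exact hr (by simp [hy])

theorem mem_ball_iff {r : ℤ} {x : K} : x ∈ ball β r ↔ valuation K (β ^ r * x) ≤ 1 := Iff.rfl

theorem zero_mem_ball (r : ℤ) : (0 : K) ∈ ball β r := by simp [mem_ball_iff]

theorem add_mem_ball {r : ℤ} {x y : K} (hx : x ∈ ball β r) (hy : y ∈ ball β r) :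
    x + y ∈ ball β r := by
  rw [mem_ball_iff, mul_add]
  exact Valuation.map_add_le _ hx hy

theorem neg_mem_ball {r : ℤ} {x : K} (hx : x ∈ ball β r) : -x ∈ ball β r := by
  rw [mem_ball_iff, mul_neg, Valuation.map_neg]
  exact hx

theorem sub_mem_ball {r : ℤ} {x y : K} (hx : x ∈ ball β r) (hy : y ∈ ball β r) :
    x - y ∈ ball β r := by
  rw [sub_eq_add_neg]
  exact add_mem_ball hx (neg_mem_ball hy)

theorem sum_mem_ball {ι : Type*} {r : ℤ} (s : Finset ι) {f : ι → K}
    (h : ∀ i ∈ s, f i ∈ ball β r) : ∑ i ∈ s, f i ∈ ball β r := by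
  rw [mem_ball_iff, Finset.mul_sum]
  exact Valuation.map_sum_le _ h

theorem mul_mem_ball (hβ : IsUniformizer β) {r s : ℤ} {x y : K} (hx : x ∈ ball β r)
    (hy : y ∈ ball β s) : x * y ∈ ball β (r + s) := by
  have e : β ^ (r + s) * (x * y) = (β ^ r * x) * (β ^ s * y) := by
    rw [zpow_add₀ hβ.ne_zero]; ring
  rw [mem_ball_iff, e, map_mul]
  exact mul_le_one' hx hy

theorem ball_mono (hβ : IsUniformizer β) {r s : ℤ} (h : r ≤ s) : ball β r ⊆ ball β s := by
  intro x hx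
  obtain ⟨k, rfl⟩ := Int.le.dest h
  have e : β ^ (r + (k : ℤ)) * x = β ^ k * (β ^ r * x) := by
    rw [zpow_add₀ hβ.ne_zero, zpow_natCast]; ring
  rw [mem_ball_iff, e, map_mul, map_pow]
  exact mul_le_one' (pow_le_one' hβ.valuation_lt_one.le _) hx

/-- The valuation is discrete: an element of valuation `> 1` has its inverse in `P = βO`, which
gains a full factor `β`. This accounts for the `- 1`. -/
theorem inv_mem_ball_of_notMem (hβ : IsUniformizer β) {r : ℤ} {y : K} (hy : y ∉ ball β r) :
    y⁻¹ ∈ ball β (-r - 1) := by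
  have h1 : 1 < valuation K (β ^ r * y) := not_le.1 hy
  have h2 : valuation K (β ^ r * y)⁻¹ < 1 := by
    rw [map_inv₀]
    exact inv_lt_one_of_one_lt₀ h1
  obtain ⟨w, hw, e⟩ := (hβ _).1 h2
  have hb := hβ.ne_zero
  have : β ^ (-r - 1) * y⁻¹ = w := by
    rw [zpow_sub₀ hb, zpow_neg, zpow_one, div_mul_eq_mul_div, ← mul_inv, e]
    field_simp
  rw [mem_ball_iff, this]
  exact hw

/-- Greedy expansion: subtract the representative of the residue class, divide by `β` and repeat. -/
theorem exists_digits (hβ : IsUniformizer β) (hS : IsResidueSystem S) (m : ℕ) (x : K)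
    (hx : valuation K x ≤ 1) : ∃ a : Fin m → K, (∀ i, a i ∈ S) ∧
      x - ∑ i, a i * β ^ (i : ℕ) ∈ ball β (-(m : ℤ)) := by
  induction m generalizing x with
  | zero => exact ⟨Fin.elim0, fun i => i.elim0, by simpa [mem_ball_iff] using hx⟩
  | succ m ih =>
    obtain ⟨s, ⟨hs, hs'⟩, -⟩ := hS.existsUnique_rep x hx
    obtain ⟨y, hy, e⟩ := (hβ _).1 hs'
    obtain ⟨a, ha, h⟩ := ih y hy
    refine ⟨Fin.cons s a, Fin.cases hs ha, ?_⟩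
    have : x - ∑ i : Fin (m + 1), (Fin.cons s a : Fin (m + 1) → K) i * β ^ (i : ℕ)
        = β * (y - ∑ i : Fin m, a i * β ^ (i : ℕ)) := by
      rw [Fin.sum_univ_succ, mul_sub, ← e, Finset.mul_sum]
      simp only [Fin.cons_zero, Fin.cons_succ, Fin.val_zero, Fin.val_succ, pow_zero, mul_one,
        pow_succ]
      rw [sub_sub]
      congr 2
      exact Finset.sum_congr rfl fun i _ => by ring
    rw [this]
    have hb : β ∈ ball β (-1) := by simp [mem_ball_iff, hβ.ne_zero]
    have := mul_mem_ball hβ hb h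
    convert this using 2
    push_cast; ring

/-- Modulo `P` only the lowest digits remain, and `S` represents each class once. After cancelling
them the difference is divided by `β`. -/
theorem digits_unique (hβ : IsUniformizer β) (hS : IsResidueSystem S) {m : ℕ} {a b : Fin m → K}
    (ha : ∀ i, a i ∈ S) (hb : ∀ i, b i ∈ S)
    (h : ∑ i, a i * β ^ (i : ℕ) - ∑ i, b i * β ^ (i : ℕ) ∈ ball β (-(m : ℤ))) : a = b := by
  induction m with
  | zero => exact Subsingleton.elim _ _
  | succ m ih =>
    have key (a : Fin (m + 1) → K) : ∑ i, a i * β ^ (i : ℕ)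
        = a 0 + β * ∑ i : Fin m, a i.succ * β ^ (i : ℕ) := by
      rw [Fin.sum_univ_succ, Finset.mul_sum]
      simp only [Fin.val_zero, Fin.val_succ, pow_zero, mul_one, pow_succ]
      congr 1
      exact Finset.sum_congr rfl fun i _ => by ring
    have hint (a : Fin (m + 1) → K) (ha : ∀ i, a i ∈ S) :
        valuation K (∑ i : Fin m, a i.succ * β ^ (i : ℕ)) ≤ 1 := by
      refine Valuation.map_sum_le _ fun i _ => ?_
      rw [map_mul, map_pow]
      exact mul_le_one' (hS.subset_integers _ (ha _)) (pow_le_one' hβ.valuation_lt_one.le _)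
    rw [key a, key b] at h
    set A := ∑ i : Fin m, a i.succ * β ^ (i : ℕ) with hA
    set B := ∑ i : Fin m, b i.succ * β ^ (i : ℕ) with hB
    have e : a 0 + β * A - (b 0 + β * B) = (a 0 - b 0) + β * (A - B) := by ring
    rw [e] at h
    have hAB : valuation K (A - B) ≤ 1 :=
      (Valuation.map_sub _ _ _).trans (max_le (hint a ha) (hint b hb))
    have h1 : valuation K ((a 0 - b 0) + β * (A - B)) < 1 := by
      obtain hh : a 0 - b 0 + β * (A - B) ∈ ball β (-1) := ball_mono hβ (by push_cast; omega) h
      refine (hβ _).2 ⟨_, hh, ?_⟩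
      rw [← mul_assoc, zpow_neg_one, mul_inv_cancel₀ hβ.ne_zero, one_mul]
    have h2 : valuation K (a 0 - b 0) < 1 := by
      have := Valuation.map_sub_lt _ h1 ((hβ _).2 ⟨A - B, hAB, rfl⟩)
      rwa [add_sub_cancel_right] at this
    have h0 : a 0 = b 0 := by
      obtain ⟨s, -, hu⟩ := hS.existsUnique_rep (a 0) (hS.subset_integers _ (ha 0))
      rw [hu (a 0) ⟨ha 0, by simp⟩, hu (b 0) ⟨hb 0, h2⟩]
    rw [h0, sub_self, zero_add] at h
    have hi : β⁻¹ ∈ ball β 1 := by simp [mem_ball_iff, hβ.ne_zero]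
    have h3 := mul_mem_ball hβ hi h
    rw [← mul_assoc, inv_mul_cancel₀ hβ.ne_zero, one_mul] at h3
    have h4 := ih (a := fun i => a i.succ) (b := fun i => b i.succ) (fun i => ha _)
      (fun i => hb _) (by convert h3 using 2; push_cast; ring)
    funext i
    exact Fin.cases h0 (fun i => congrFun h4 i) i

theorem digits_scale (hβ : IsUniformizer β) (n m : ℕ) (a : Fin m → K) :
    ∑ i : Fin m, a i * β ^ ((i : ℤ) - (n : ℤ)) =
      β ^ (-(n : ℤ)) * ∑ i : Fin m, a i * β ^ (i : ℕ) := by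
  rw [Finset.mul_sum]
  refine Finset.sum_congr rfl fun i _ => ?_
  rw [sub_eq_add_neg, zpow_add₀ hβ.ne_zero, zpow_natCast]
  ring

theorem mem_grid_iff {x : K} : x ∈ grid β S n ↔ ∃ a : Fin (2 * n) → K, (∀ i, a i ∈ S) ∧
    ∑ i : Fin (2 * n), a i * β ^ ((i : ℤ) - (n : ℤ)) = x := by
  simp [grid]

theorem zpow_neg_mem_ball (hβ : IsUniformizer β) (r : ℤ) : β ^ (-r) ∈ ball β r := by
  rw [mem_ball_iff, ← zpow_add₀ hβ.ne_zero]
  simp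

theorem mem_ball_of_mem_grid (hβ : IsUniformizer β) (hS : IsResidueSystem S) {x : K}
    (hx : x ∈ grid β S n) : x ∈ ball β n := by
  obtain ⟨a, ha, rfl⟩ := mem_grid_iff.1 hx
  rw [digits_scale hβ]
  have h : ∑ i : Fin (2 * n), a i * β ^ (i : ℕ) ∈ ball β 0 := by
    refine sum_mem_ball _ fun i _ => ?_
    rw [mem_ball_iff, zpow_zero, one_mul, map_mul, map_pow]
    exact mul_le_one' (hS.subset_integers _ (ha _)) (pow_le_one' hβ.valuation_lt_one.le _)
  simpa using mul_mem_ball hβ (zpow_neg_mem_ball hβ n) h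

theorem zero_mem_grid (hS : IsResidueSystem S) : (0 : K) ∈ grid β S n :=
  mem_grid_iff.2 ⟨0, fun _ => hS.zero_mem, by simp⟩

theorem exists_mem_grid (hβ : IsUniformizer β) (hS : IsResidueSystem S) {x : K}
    (hx : x ∈ ball β n) : ∃ y ∈ grid β S n, x - y ∈ ball β (-(n : ℤ)) := by
  obtain ⟨a, ha, h⟩ := exists_digits hβ hS (2 * n) _ hx
  refine ⟨_, mem_grid_iff.2 ⟨a, ha, rfl⟩, ?_⟩
  have := mul_mem_ball hβ (zpow_neg_mem_ball hβ n) h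
  rw [mul_sub, ← digits_scale hβ, ← mul_assoc, ← zpow_add₀ hβ.ne_zero] at this
  convert this using 1
  · push_cast; congr 1; ring
  · simp

theorem digits_eq_of_sub_mem_ball (hβ : IsUniformizer β) (hS : IsResidueSystem S)
    {a b : Fin (2 * n) → K} (ha : ∀ i, a i ∈ S) (hb : ∀ i, b i ∈ S)
    (h : ∑ i : Fin (2 * n), a i * β ^ ((i : ℤ) - (n : ℤ)) -
      ∑ i : Fin (2 * n), b i * β ^ ((i : ℤ) - (n : ℤ)) ∈ ball β (-(n : ℤ))) : a = b := by
  refine digits_unique hβ hS ha hb ?_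
  rw [digits_scale hβ, digits_scale hβ, ← mul_sub] at h
  have := mul_mem_ball hβ (zpow_neg_mem_ball hβ (-(n : ℤ))) h
  rw [← mul_assoc, ← zpow_add₀ hβ.ne_zero] at this
  convert this using 1
  · push_cast; congr 1; ring
  · simp

theorem grid_eq_of_sub_mem_ball (hβ : IsUniformizer β) (hS : IsResidueSystem S) {x y : K}
    (hx : x ∈ grid β S n) (hy : y ∈ grid β S n) (h : x - y ∈ ball β (-(n : ℤ))) : x = y := by
  obtain ⟨a, ha, rfl⟩ := mem_grid_iff.1 hx
  obtain ⟨b, hb, rfl⟩ := mem_grid_iff.1 hy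
  rw [digits_eq_of_sub_mem_ball hβ hS ha hb h]

theorem IsResidueSystem.card_eq (hS : IsResidueSystem S) : S.card = residueCard K := by
  classical
  rw [residueCard, ← Nat.card_eq_finsetCard]
  let φ : S → IsLocalRing.ResidueField (valuation K).integer := fun s =>
    IsLocalRing.residue _ ⟨s, hS.subset_integers _ s.2⟩
  have hlt (x : (valuation K).integer) :
      IsLocalRing.residue _ x = 0 ↔ valuation K (x : K) < 1 := by
    rw [IsLocalRing.residue_eq_zero_iff, IsLocalRing.mem_maximalIdeal, mem_nonunits_iff,
      Valuation.Integers.isUnit_iff_valuation_eq_one (Valuation.integer.integers (valuation K))]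
    exact ⟨fun h => lt_of_le_of_ne x.2 h, fun h => h.ne⟩
  refine Nat.card_eq_of_bijective φ ⟨?_, ?_⟩
  · intro s s' h
    have h1 : valuation K ((s : K) - s') < 1 := by
      have := (hlt (⟨s, hS.subset_integers _ s.2⟩ - ⟨s', hS.subset_integers _ s'.2⟩)).1
        (by rw [map_sub, sub_eq_zero]; exact h)
      exact this
    obtain ⟨r, -, hu⟩ := hS.existsUnique_rep s (hS.subset_integers _ s.2)
    exact Subtype.ext ((hu s ⟨s.2, by simp⟩).trans (hu s' ⟨s'.2, h1⟩).symm)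
  · intro r
    obtain ⟨x, rfl⟩ := IsLocalRing.residue_surjective r
    obtain ⟨s, ⟨hs, h⟩, -⟩ := hS.existsUnique_rep x x.2
    refine ⟨⟨s, hs⟩, ?_⟩
    have := (hlt (x - ⟨s, hS.subset_integers _ hs⟩)).2 h
    rw [map_sub, sub_eq_zero] at this
    exact this.symm

theorem card_grid (hβ : IsUniformizer β) (hS : IsResidueSystem S) :
    (grid β S n).card = residueCard K ^ (2 * n) := by
  classical
  rw [grid, Finset.card_image_of_injOn]
  · rw [Fintype.card_piFinset_const, hS.card_eq]
  · intro a ha b hb h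
    refine digits_eq_of_sub_mem_ball hβ hS (fun i => ?_) (fun i => ?_)
      (by rw [sub_eq_zero.2 (show _ = _ from h)]; exact zero_mem_ball _)
    · exact Fintype.mem_piFinset.1 ha i
    · exact Fintype.mem_piFinset.1 hb i

theorem IsResidueSystem.residueCard_pos (hS : IsResidueSystem S) : 0 < residueCard K := by
  rw [← hS.card_eq]
  exact Finset.card_pos.2 ⟨0, hS.zero_mem⟩

/-- The representative in `X_n` of a class modulo `B_{-n}` (and `0` outside `B_n`). -/
def gridRep (β : K) (S : Finset K) (n : ℕ) (x : K) : K :=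
  open Classical in
  if h : ∃ y ∈ grid β S n, x - y ∈ ball β (-(n : ℤ)) then h.choose else 0

theorem gridRep_mem (hS : IsResidueSystem S) (x : K) : gridRep β S n x ∈ grid β S n := by
  unfold gridRep
  split_ifs with h
  · exact h.choose_spec.1
  · exact zero_mem_grid hS

theorem sub_gridRep_mem (hβ : IsUniformizer β) (hS : IsResidueSystem S) {x : K}
    (hx : x ∈ ball β n) : x - gridRep β S n x ∈ ball β (-(n : ℤ)) := by
  have h := exists_mem_grid hβ hS hx
  rw [gridRep, dif_pos h]
  exact h.choose_spec.2

theorem gridRep_eq_iff (hβ : IsUniformizer β) (hS : IsResidueSystem S) {x y : K}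
    (hx : x ∈ ball β n) (hy : y ∈ grid β S n) :
    gridRep β S n x = y ↔ x - y ∈ ball β (-(n : ℤ)) := by
  have h := sub_gridRep_mem hβ hS hx
  refine ⟨fun e => e ▸ h, fun h' => ?_⟩
  refine grid_eq_of_sub_mem_ball hβ hS (gridRep_mem hS x) hy ?_
  have := sub_mem_ball h' h
  rwa [sub_sub_sub_cancel_left] at this

/-- Passing to the representative changes `x ∉ B_{-n}` by something no larger than `x`, while the
class `B_{-n}` is represented by `0`. Thus sets of the form `|x| ≤ c` in the grid are closed under
the addition of `B_n / B_{-n}`. -/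
theorem valuation_gridRep_le (hβ : IsUniformizer β) (hS : IsResidueSystem S) {x : K}
    (hx : x ∈ ball β n) : valuation K (gridRep β S n x) ≤ valuation K x := by
  by_cases h0 : x ∈ ball β (-(n : ℤ))
  · rw [(gridRep_eq_iff hβ hS hx (zero_mem_grid hS)).2 (by simpa using h0)]
    simp
  · have h := sub_gridRep_mem hβ hS hx
    have hle : valuation K (x - gridRep β S n x) ≤ valuation K x := by
      rw [mem_ball_iff] at h h0
      have hb : 0 < valuation K (β ^ (-(n : ℤ))) := by
        rw [zero_lt_iff, Valuation.ne_zero_iff]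
        exact zpow_ne_zero _ hβ.ne_zero
      rw [map_mul] at h h0
      exact le_of_mul_le_mul_left (h.trans (not_le.1 h0).le) hb
    have := (Valuation.map_sub (valuation K) x (x - gridRep β S n x)).trans (max_le le_rfl hle)
    rwa [sub_sub_cancel] at this

theorem isOpen_ball (r : ℤ) : IsOpen (ball β r) := by
  have h0 : {x : K | valuation K x ≤ 1} ∈ 𝓝 (0 : K) := by
    refine (IsValuativeTopology.hasBasis_nhds_zero' K).mem_iff.2 ⟨1, one_ne_zero, ?_⟩
    exact fun x hx => (show valuation K x < 1 from hx).le
  have h1 : ball β r ∈ 𝓝 (0 : K) := by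
    have hc : Continuous fun x : K => β ^ r * x := continuous_const.mul continuous_id
    exact hc.continuousAt.preimage_mem_nhds (x := 0) (t := {x | valuation K x ≤ 1}) (by simpa using h0)
  rw [isOpen_iff_mem_nhds]
  intro x hx
  have hc : Continuous fun y : K => y - x := continuous_id.sub continuous_const
  have : (fun y : K => y - x) ⁻¹' ball β r ∈ 𝓝 x :=
    hc.continuousAt.preimage_mem_nhds (by simpa using h1)
  filter_upwards [this] with y hy
  simpa using add_mem_ball hy hx

theorem isClopen_ball (r : ℤ) : IsClopen (ball β r) := by
  refine ⟨⟨isOpen_iff_mem_nhds.2 fun x hx => ?_⟩, isOpen_ball r⟩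
  have hc : Continuous fun y : K => x - y := continuous_const.sub continuous_id
  have : (fun y : K => x - y) ⁻¹' ball β r ∈ 𝓝 x :=
    ((isOpen_ball r).preimage hc).mem_nhds (by simpa using zero_mem_ball r)
  filter_upwards [this] with y hy hy'
  exact hx (by simpa using add_mem_ball hy hy')

theorem canonicalAbs_mul (x y : K) : canonicalAbs (x * y) = canonicalAbs x * canonicalAbs y := by
  by_cases hx : x = 0
  · simp [canonicalAbs, hx]
  by_cases hy : y = 0
  · simp [canonicalAbs, hy]
  rw [canonicalAbs, canonicalAbs, canonicalAbs, dif_neg hx, dif_neg hy, dif_neg (mul_ne_zero hx hy),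
    ← NNReal.coe_mul, ← map_mul]
  congr 2
  ext
  simp

theorem canonicalAbs_nonneg (x : K) : 0 ≤ canonicalAbs x := by
  unfold canonicalAbs
  split_ifs <;> simp

/-- Multiplication by `x` maps `O` into itself, and `O`, a compact neighbourhood of `0`, has finite
nonzero Haar measure. -/
theorem canonicalAbs_le_one {x : K} (h : valuation K x ≤ 1) : canonicalAbs x ≤ 1 := by
  borelize K
  by_cases hx : x = 0
  · simp [canonicalAbs, hx]
  rw [canonicalAbs, dif_neg hx]
  have hc := IsNonarchimedeanLocalField.isCompact_closedBall K 1
  have hnhds : {x : K | valuation K x ≤ 1} ∈ 𝓝 (0 : K) :=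
    (IsValuativeTopology.hasBasis_nhds_zero' K).mem_iff.2
      ⟨1, one_ne_zero, fun x hx => (show valuation K x < 1 from hx).le⟩
  have hpos : (Measure.addHaar : Measure K) {x : K | valuation K x ≤ 1} ≠ 0 :=
    (Measure.measure_pos_of_mem_nhds _ hnhds).ne'
  have hfin : (Measure.addHaar : Measure K) {x : K | valuation K x ≤ 1} ≠ ⊤ :=
    hc.measure_lt_top.ne
  have hle : (distribHaarChar K (Units.mk0 x hx) : ENNReal) ≤ 1 := by
    rw [distribHaarChar_eq_div (μ := Measure.addHaar) hpos hfin]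
    refine ENNReal.div_le_of_le_mul ?_
    rw [one_mul]
    refine measure_mono ?_
    rintro _ ⟨y, hy, rfl⟩
    change valuation K (x * y) ≤ 1
    rw [map_mul]
    exact mul_le_one' h hy
  exact_mod_cast hle

/-- Monotonicity is all that has to be known about the Haar modulus: it transfers the ultrametric
inequality to its level sets. -/
theorem canonicalAbs_le_of_valuation_le {x y : K} (h : valuation K x ≤ valuation K y) :
    canonicalAbs x ≤ canonicalAbs y := by
  by_cases hy : y = 0
  · have hx : x = 0 := by simpa [hy] using h
    simp [hx, hy]
  · have e : x = (x / y) * y := by field_simp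
    rw [e, canonicalAbs_mul]
    refine mul_le_of_le_one_left (canonicalAbs_nonneg y) (canonicalAbs_le_one ?_)
    rw [map_div₀]
    exact div_le_one_of_le₀ h zero_le

end Arithmetic

/-! ### Character sums on the grid and positivity of the jump weights -/

section Characters

variable {K : Type*} [Field K] [ValuativeRel K] [TopologicalSpace K]
  [IsNonarchimedeanLocalField K] {β : K} {S : Finset K} {n : ℕ} {χ : AddChar K Circle}

theorem HasRankZero.eq_one (hχ : HasRankZero β χ) {x : K} (hx : x ∈ ball β 0) : χ x = 1 :=
  hχ.1 x hx

/-- `B_n · B_{-n} ⊆ O` and `χ` is trivial on `O`, so the pairing `χ(xy)` descends to `B_n / B_{-n}`.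
-/
theorem char_gridRep (hβ : IsUniformizer β) (hS : IsResidueSystem S) (hχ : HasRankZero β χ)
    {x y : K} (hx : x ∈ ball β n) (hy : y ∈ ball β n) : χ (x * gridRep β S n y) = χ (x * y) := by
  have e : x * y = x * gridRep β S n y + x * (y - gridRep β S n y) := by ring
  have h : x * (y - gridRep β S n y) ∈ ball β 0 := by
    simpa using mul_mem_ball hβ hx (sub_gridRep_mem hβ hS hy)
  rw [e, AddChar.map_add_eq_mul, hχ.eq_one h, mul_one]

/-- The sum of a nontrivial character over a subset of the grid that is closed under the addition
of `B_n / B_{-n}` vanishes. -/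
theorem sum_char_eq_zero (hβ : IsUniformizer β) (hS : IsResidueSystem S) (hχ : HasRankZero β χ)
    {T : Finset K} (hT : T ⊆ grid β S n)
    (hadd : ∀ x ∈ T, ∀ y ∈ T, gridRep β S n (x + y) ∈ T) {z h : K} (hz : z ∈ ball β n)
    (hh : h ∈ T) (hne : χ (z * h) ≠ 1) : ∑ ξ ∈ T, (χ (z * ξ) : ℂ) = 0 := by
  have hb {x : K} (hx : x ∈ T) : x ∈ ball β n := mem_ball_of_mem_grid hβ hS (hT hx)
  have hinj : Set.InjOn (fun ξ => gridRep β S n (ξ + h)) T := by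
    intro x hx y hy e
    have h1 := sub_gridRep_mem hβ hS (add_mem_ball (hb hx) (hb hh))
    have h2 := sub_gridRep_mem hβ hS (add_mem_ball (hb hy) (hb hh))
    rw [show gridRep β S n (x + h) = gridRep β S n (y + h) from e] at h1
    refine grid_eq_of_sub_mem_ball hβ hS (hT hx) (hT hy) ?_
    convert sub_mem_ball h1 h2 using 1
    ring
  have hmaps : Set.MapsTo (fun ξ => gridRep β S n (ξ + h)) T T := fun x hx => hadd x hx h hh
  have hsurj := Finset.surjOn_of_injOn_of_card_le _ hmaps hinj le_rfl
  -- Translation by `h` permutes `T` and multiplies the sum by `χ(zh) ≠ 1`.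
  have key : ∑ ξ ∈ T, (χ (z * ξ) : ℂ) = ∑ ξ ∈ T, (χ (z * ξ) : ℂ) * χ (z * h) := by
    refine (Finset.sum_nbij (fun ξ => gridRep β S n (ξ + h)) hmaps hinj hsurj ?_).symm
    intro ξ hξ
    rw [char_gridRep hβ hS hχ hz (add_mem_ball (hb hξ) (hb hh)), mul_add,
      AddChar.map_add_eq_mul, Circle.coe_mul]
  rw [← Finset.sum_mul] at key
  have h1 : (χ (z * h) : ℂ) - 1 ≠ 0 := by
    rw [sub_ne_zero]
    exact fun e => hne (Circle.ext (by rw [e, Circle.coe_one]))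
  have h2 : (∑ ξ ∈ T, (χ (z * ξ) : ℂ)) * ((χ (z * h) : ℂ) - 1) = 0 := by
    rw [mul_sub, ← key, mul_one, sub_self]
  exact (mul_eq_zero.1 h2).resolve_right h1

/-- Nondegeneracy of the pairing. Rank zero provides `z ∈ B_1` with `χ(z) ≠ 1`, and `y ∉ B_{-n}`
forces `z / y ∈ B_n`; the witness is the representative of `z / y`. -/
theorem exists_char_ne_one (hβ : IsUniformizer β) (hS : IsResidueSystem S)
    (hχ : HasRankZero β χ) {y : K} (hy : y ∈ ball β n) (hy' : y ∉ ball β (-(n : ℤ))) :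
    ∃ h ∈ grid β S n, χ (y * h) ≠ 1 := by
  have h1 : ¬ ∀ x ∈ ball β 1, χ x = 1 := fun h => absurd (hχ.2 h) (by norm_num)
  push Not at h1
  obtain ⟨z, hz, hz1⟩ := h1
  have hy0 : y ≠ 0 := by
    rintro rfl
    exact hy' (zero_mem_ball _)
  have hzy : z * y⁻¹ ∈ ball β n := by
    convert mul_mem_ball hβ hz (inv_mem_ball_of_notMem hβ hy') using 2
    ring
  refine ⟨_, gridRep_mem hS (z * y⁻¹), ?_⟩
  rw [char_gridRep hβ hS hχ hy hzy]
  convert hz1 using 2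
  field_simp

theorem sum_char_grid (hβ : IsUniformizer β) (hS : IsResidueSystem S) (hχ : HasRankZero β χ)
    {y : K} (hy : y ∈ ball β n) [Decidable (y ∈ ball β (-(n : ℤ)))] :
    ∑ ξ ∈ grid β S n, (χ (y * ξ) : ℂ) =
      if y ∈ ball β (-(n : ℤ)) then (residueCard K : ℂ) ^ (2 * n) else 0 := by
  split_ifs with h
  · have : ∀ ξ ∈ grid β S n, (χ (y * ξ) : ℂ) = 1 := fun ξ hξ => by
      rw [hχ.eq_one, Circle.coe_one]
      simpa using mul_mem_ball hβ h (mem_ball_of_mem_grid hβ hS hξ)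
    rw [Finset.sum_congr rfl this]
    simp [card_grid hβ hS]
  · obtain ⟨h0, hh, hne⟩ := exists_char_ne_one hβ hS hχ hy h
    exact sum_char_eq_zero hβ hS hχ subset_rfl (fun x _ y _ => gridRep_mem hS _) hy hh hne

theorem sum_char_grid_sub (hβ : IsUniformizer β) (hS : IsResidueSystem S)
    (hχ : HasRankZero β χ) {x y : K} (hx : x ∈ grid β S n) (hy : y ∈ grid β S n)
    [Decidable (x = y)] :
    ∑ ξ ∈ grid β S n, (χ ((x - y) * ξ) : ℂ) =
      if x = y then (residueCard K : ℂ) ^ (2 * n) else 0 := by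
  classical
  rw [sum_char_grid hβ hS hχ
    (sub_mem_ball (mem_ball_of_mem_grid hβ hS hx) (mem_ball_of_mem_grid hβ hS hy))]
  congr 1
  rw [eq_iff_iff]
  exact ⟨grid_eq_of_sub_mem_ball hβ hS hx hy, by rintro rfl; simpa using zero_mem_ball _⟩

/-- The ultrametric inequality makes the level set closed under addition. A character that is
trivial on it sums to the cardinality, any other one to `0`. -/
theorem sum_char_level_nonneg (hβ : IsUniformizer β) (hS : IsResidueSystem S)
    (hχ : HasRankZero β χ) {α : ℝ} (hα : 0 < α) {z : K} (hz : z ∈ ball β n) (ρ : ℝ) :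
    ∃ c : ℝ, 0 ≤ c ∧
      ∑ ξ ∈ grid β S n with canonicalAbs ξ ^ α ≤ ρ, (χ (z * ξ) : ℂ) = c := by
  set T := (grid β S n).filter fun ξ => canonicalAbs ξ ^ α ≤ ρ
  by_cases hall : ∀ h ∈ T, χ (z * h) = 1
  · refine ⟨T.card, by positivity, ?_⟩
    rw [Finset.sum_congr rfl fun h hh => by rw [hall h hh, Circle.coe_one]]
    simp
  · push Not at hall
    obtain ⟨h, hh, hne⟩ := hall
    refine ⟨0, le_rfl, ?_⟩
    rw [sum_char_eq_zero hβ hS hχ (Finset.filter_subset _ _) ?_ hz hh hne, Complex.ofReal_zero]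
    intro x hx y hy
    rw [Finset.mem_filter] at hx hy ⊢
    refine ⟨gridRep_mem hS _, ?_⟩
    have h1 := valuation_gridRep_le hβ hS
      (add_mem_ball (mem_ball_of_mem_grid hβ hS hx.1) (mem_ball_of_mem_grid hβ hS hy.1))
    rcases le_max_iff.1 (h1.trans (Valuation.map_add _ x y)) with h2 | h2
    · exact (Real.rpow_le_rpow (canonicalAbs_nonneg _) (canonicalAbs_le_of_valuation_le h2)
        hα.le).trans hx.2
    · exact (Real.rpow_le_rpow (canonicalAbs_nonneg _) (canonicalAbs_le_of_valuation_le h2)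
        hα.le).trans hy.2

/-- Layer cake decomposition: a sum with the weights `C - g i` is nonnegative as soon as all the
sums over the level sets of `g` are. -/
theorem sum_sub_mul_nonneg_of_level {ι : Type*} (T : Finset ι) {g : ι → ℝ} {C : ℝ} (F : ι → ℂ)
    (hC : ∀ i ∈ T, g i ≤ C) (hg : ∀ i ∈ T, 0 ≤ g i)
    (h : ∀ ρ : ℝ, ∃ c : ℝ, 0 ≤ c ∧ ∑ i ∈ T with g i ≤ ρ, F i = c) :
    ∃ c : ℝ, 0 ≤ c ∧ ∑ i ∈ T, ((C - g i : ℝ) : ℂ) * F i = c := by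
  choose c hc0 hc using h
  refine ⟨∫ r in Set.Icc 0 C, c r, integral_nonneg hc0, ?_⟩
  rw [← integral_complex_ofReal]
  -- `C - g i` is the length of `[g i, C]`, the part of `[0, C]` where `i` belongs to the level set.
  have key : ∀ i ∈ T, ((C - g i : ℝ) : ℂ) * F i =
      ∫ r in Set.Icc 0 C, (Set.Ici (g i)).indicator (fun _ => F i) r := by
    intro i hi
    rw [setIntegral_indicator measurableSet_Ici, setIntegral_const]
    have : Set.Icc 0 C ∩ Set.Ici (g i) = Set.Icc (g i) C := by
      ext r
      simp only [Set.mem_inter_iff, Set.mem_Icc, Set.mem_Ici]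
      have := hg i hi
      constructor
      · rintro ⟨⟨_, h⟩, h'⟩; exact ⟨h', h⟩
      · rintro ⟨h, h'⟩; exact ⟨⟨this.trans h, h'⟩, h⟩
    rw [this, Real.volume_real_Icc_of_le (hC i hi)]
    simp
  rw [Finset.sum_congr rfl key, ← integral_finsetSum]
  · refine integral_congr_ae (Eventually.of_forall fun r => ?_)
    change ∑ i ∈ T, (Set.Ici (g i)).indicator (fun _ => F i) r = (c r : ℂ)
    rw [← hc r, Finset.sum_filter]
    refine Finset.sum_congr rfl fun i _ => ?_
    simp [Set.indicator_apply]
  · intro i _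
    refine Integrable.indicator ?_ measurableSet_Ici
    exact integrable_const _

/-- The total jump rate of the path process. -/
def jumpRate (β : K) (S : Finset K) (n : ℕ) (α : ℝ) : ℝ := ∑ ξ ∈ grid β S n, canonicalAbs ξ ^ α

/-- The rate of the jumps `z` of the path process. -/
def jumpWeight (β : K) (S : Finset K) (n : ℕ) (χ : AddChar K Circle) (α : ℝ) (z : K) : ℝ :=
  (((residueCard K : ℂ) ^ (2 * n))⁻¹ * ∑ ξ ∈ grid β S n,
    ((jumpRate β S n α - canonicalAbs ξ ^ α : ℝ) : ℂ) * (χ (z * ξ) : ℂ)).re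

/-- The layer cake decomposition reduces this to level sets; `C = jumpRate` is admissible since a
sum of nonnegative terms dominates each of them. The character sum is real, so the real part in
`jumpWeight` loses nothing. -/
theorem jumpWeight_spec (hβ : IsUniformizer β) (hS : IsResidueSystem S) (hχ : HasRankZero β χ)
    {α : ℝ} (hα : 0 < α) {z : K} (hz : z ∈ grid β S n) :
    0 ≤ jumpWeight β S n χ α z ∧ (jumpWeight β S n χ α z : ℂ) =
      ((residueCard K : ℂ) ^ (2 * n))⁻¹ * ∑ ξ ∈ grid β S n,
        ((jumpRate β S n α - canonicalAbs ξ ^ α : ℝ) : ℂ) * (χ (z * ξ) : ℂ) := by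
  have hnn : ∀ ξ ∈ grid β S n, 0 ≤ canonicalAbs ξ ^ α := fun ξ _ =>
    Real.rpow_nonneg (canonicalAbs_nonneg ξ) α
  obtain ⟨c, hc0, hc⟩ := sum_sub_mul_nonneg_of_level (grid β S n)
    (g := fun ξ => canonicalAbs ξ ^ α) (C := jumpRate β S n α) (fun ξ => (χ (z * ξ) : ℂ))
    (fun ξ hξ => Finset.single_le_sum hnn hξ) hnn
    (sum_char_level_nonneg hβ hS hχ hα (mem_ball_of_mem_grid hβ hS hz))
  have e : ((residueCard K : ℂ) ^ (2 * n))⁻¹ * ∑ ξ ∈ grid β S n,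
        ((jumpRate β S n α - canonicalAbs ξ ^ α : ℝ) : ℂ) * (χ (z * ξ) : ℂ) =
      ((((residueCard K : ℝ) ^ (2 * n))⁻¹ * c : ℝ) : ℂ) := by
    rw [hc]; push_cast; rfl
  rw [jumpWeight, e, Complex.ofReal_re]
  exact ⟨by positivity, rfl⟩

/-- Fourier inversion on the finite group, by orthogonality of characters. -/
theorem sum_jumpWeight_mul_char (hβ : IsUniformizer β) (hS : IsResidueSystem S)
    (hχ : HasRankZero β χ) {α : ℝ} (hα : 0 < α) {η : K} (hη : η ∈ grid β S n) :
    ∑ z ∈ grid β S n, (jumpWeight β S n χ α z : ℂ) * (χ (-(η * z)) : ℂ) =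
      ((jumpRate β S n α - canonicalAbs η ^ α : ℝ) : ℂ) := by
  classical
  have hq : (residueCard K : ℂ) ≠ 0 := Nat.cast_ne_zero.2 hS.residueCard_pos.ne'
  rw [Finset.sum_congr rfl fun z hz => by rw [(jumpWeight_spec hβ hS hχ hα hz).2]]
  simp_rw [Finset.mul_sum, Finset.sum_mul]
  rw [Finset.sum_comm]
  have : ∀ ξ ∈ grid β S n, ∑ z ∈ grid β S n, ((residueCard K : ℂ) ^ (2 * n))⁻¹ *
      (((jumpRate β S n α - canonicalAbs ξ ^ α : ℝ) : ℂ) * (χ (z * ξ) : ℂ)) * (χ (-(η * z)) : ℂ) =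
      if ξ = η then ((jumpRate β S n α - canonicalAbs ξ ^ α : ℝ) : ℂ) else 0 := by
    intro ξ hξ
    have h1 : ∀ z : K, ((residueCard K : ℂ) ^ (2 * n))⁻¹ *
      (((jumpRate β S n α - canonicalAbs ξ ^ α : ℝ) : ℂ) * (χ (z * ξ) : ℂ)) * (χ (-(η * z)) : ℂ) =
      (((residueCard K : ℂ) ^ (2 * n))⁻¹ * ((jumpRate β S n α - canonicalAbs ξ ^ α : ℝ) : ℂ)) *
        (χ ((ξ - η) * z) : ℂ) := fun z => by
      rw [show (ξ - η) * z = z * ξ + -(η * z) by ring, AddChar.map_add_eq_mul, Circle.coe_mul]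
      ring
    simp_rw [h1]
    rw [← Finset.mul_sum, sum_char_grid_sub hβ hS hχ hξ hη]
    split_ifs
    · field_simp
    · simp
  rw [Finset.sum_congr rfl this, Finset.sum_ite_eq', if_pos hη]

end Characters

/-- Makes points closed, so that singletons of `K` and the set `X_n` are Borel. -/
instance t2Space (K : Type*) [Field K] [ValuativeRel K] [TopologicalSpace K]
    [IsNonarchimedeanLocalField K] : T2Space K := by
  let := IsTopologicalAddGroup.rightUniformSpace K
  have := isUniformAddGroup_of_addCommGroup (G := K)
  infer_instance

/-! ### Step paths and the compound Poisson law -/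

section JumpPaths

variable {K : Type*} [Field K] [ValuativeRel K] [TopologicalSpace K]
  [IsNonarchimedeanLocalField K] {β : K} {S : Finset K} {n : ℕ} {χ : AddChar K Circle}

/-- The sum of `a` and the jumps `(ω j).2` at the times `(ω j).1 ∈ (0,t)` up to the time `s`. -/
def jumpSum {k : ℕ} (t : ℝ) (a : K) (ω : Fin k → ℝ × grid β S n) (s : ℝ) : K :=
  open Classical in
  a + ∑ j, if 0 < (ω j).1 ∧ (ω j).1 < t ∧ (ω j).1 ≤ s then ((ω j).2 : K) else 0

theorem jumpSum_zero {k : ℕ} (t : ℝ) (a : K) (ω : Fin k → ℝ × grid β S n) :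
    jumpSum t a ω 0 = a := by
  unfold jumpSum
  rw [Finset.sum_eq_zero, add_zero]
  intro j _
  rw [if_neg]
  rintro ⟨h1, -, h2⟩
  exact absurd h1 (not_lt.2 h2)

theorem jumpSum_mem_ball (hβ : IsUniformizer β) (hS : IsResidueSystem S) {k : ℕ} (t : ℝ) {a : K}
    (ha : a ∈ grid β S n) (ω : Fin k → ℝ × grid β S n) (s : ℝ) :
    jumpSum t a ω s ∈ ball β n := by
  refine add_mem_ball (mem_ball_of_mem_grid hβ hS ha) (sum_mem_ball _ fun j _ => ?_)
  split_ifs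
  · exact mem_ball_of_mem_grid hβ hS (ω j).2.2
  · exact zero_mem_ball _

theorem jumpSum_sub {k : ℕ} (t : ℝ) (a : K) (ω : Fin k → ℝ × grid β S n) {r s : ℝ}
    (h : r ≤ s) : open Classical in jumpSum t a ω s - jumpSum t a ω r =
      ∑ j, if (ω j).1 ∈ Set.Ioo 0 t ∩ Set.Ioc r s then ((ω j).2 : K) else 0 := by
  classical
  rw [jumpSum, jumpSum, add_sub_add_left_eq_sub, ← Finset.sum_sub_distrib]
  refine Finset.sum_congr rfl fun j _ => ?_
  simp only [Set.mem_inter_iff, Set.mem_Ioo, Set.mem_Ioc]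
  by_cases h1 : 0 < (ω j).1 ∧ (ω j).1 < t
  · by_cases h2 : (ω j).1 ≤ r
    · have h3 : (ω j).1 ≤ s := h2.trans h
      simp [h1, h2, h3]
    · by_cases h3 : (ω j).1 ≤ s
      · simp [h1, h2, h3, not_le.1 h2]
      · simp [h1, h2, h3]
  · have h4 (p : Prop) : ¬ (0 < (ω j).1 ∧ (ω j).1 < t ∧ p) := fun h => h1 ⟨h.1, h.2.1⟩
    simp [h4, h1]

theorem eventually_jumpSum_right {k : ℕ} (t : ℝ) (a : K) (ω : Fin k → ℝ × grid β S n)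
    (s : Set.Icc (0 : ℝ) t) : ∀ᶠ r : Set.Icc (0 : ℝ) t in 𝓝[>] s,
      jumpSum t a ω r = jumpSum t a ω s := by
  have h : ∀ᶠ r : Set.Icc (0 : ℝ) t in 𝓝[>] s, ∀ j, (ω j).1 ≤ r ↔ (ω j).1 ≤ s := by
    rw [eventually_all]
    intro j
    by_cases hj : (ω j).1 ≤ s
    · filter_upwards [self_mem_nhdsWithin] with r hr
      exact ⟨fun _ => hj, fun _ => hj.trans (Subtype.coe_lt_coe.2 hr).le⟩
    · have : ∀ᶠ r : Set.Icc (0 : ℝ) t in 𝓝 s, (r : ℝ) < (ω j).1 :=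
        continuous_subtype_val.continuousAt.eventually_lt continuousAt_const (not_le.1 hj)
      filter_upwards [nhdsWithin_le_nhds this] with r hr
      exact ⟨fun h => absurd hr (not_lt.2 h), fun h => absurd h hj⟩
  filter_upwards [h] with r hr
  simp only [jumpSum, hr]

theorem eventually_jumpSum_left {k : ℕ} (t : ℝ) (a : K) (ω : Fin k → ℝ × grid β S n)
    (s : Set.Icc (0 : ℝ) t) : ∀ᶠ r : Set.Icc (0 : ℝ) t in 𝓝[<] s,
      jumpSum t a ω r = open Classical in
        a + ∑ j, if 0 < (ω j).1 ∧ (ω j).1 < t ∧ (ω j).1 < s then ((ω j).2 : K) else 0 := by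
  have h : ∀ᶠ r : Set.Icc (0 : ℝ) t in 𝓝[<] s, ∀ j, (ω j).1 ≤ r ↔ (ω j).1 < s := by
    rw [eventually_all]
    intro j
    by_cases hj : (ω j).1 < s
    · have : ∀ᶠ r : Set.Icc (0 : ℝ) t in 𝓝 s, (ω j).1 < (r : ℝ) :=
        continuousAt_const.eventually_lt continuous_subtype_val.continuousAt hj
      filter_upwards [nhdsWithin_le_nhds this] with r hr
      exact ⟨fun _ => hj, fun _ => hr.le⟩
    · filter_upwards [self_mem_nhdsWithin] with r hr
      exact ⟨fun h => absurd (h.trans_lt (Subtype.coe_lt_coe.2 hr)) hj, fun h => absurd h hj⟩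
  filter_upwards [h] with r hr
  simp only [jumpSum, hr]

/-- The path in `X_n` which starts at `a` and has the jumps `(ω j).2` at the times `(ω j).1`. -/
def jumpPath {k : ℕ} (t : ℝ) (a : K) (ω : Fin k → ℝ × grid β S n) : skorokhod K t :=
  ⟨fun s => gridRep β S n (jumpSum t a ω s), by
    refine ⟨fun s _ => ?_, fun s _ => ?_, fun s hs => ?_⟩
    · refine tendsto_const_nhds.congr' ?_
      filter_upwards [eventually_jumpSum_right t a ω s] with r hr
      rw [hr]
    · exact ⟨_, tendsto_const_nhds.congr' ((eventually_jumpSum_left t a ω s).mono fun r hr =>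
        (congrArg (gridRep β S n) hr).symm)⟩
    -- Left continuity at `t`: only jump times `< t` are counted, so at `s = t` the conditions `≤ s`
    -- and `< s` select the same jumps.
    · refine tendsto_const_nhds.congr' ?_
      filter_upwards [eventually_jumpSum_left t a ω s] with r hr
      rw [hr, jumpSum]
      congr 2
      refine Finset.sum_congr rfl fun j _ => ?_
      congr 1
      rw [eq_iff_iff, hs]
      exact ⟨fun h => ⟨h.1, h.2.1, h.2.1⟩, fun h => ⟨h.1, h.2.1, h.2.1.le⟩⟩⟩

theorem jumpPath_apply {k : ℕ} (t : ℝ) (a : K) (ω : Fin k → ℝ × grid β S n)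
    (s : Set.Icc (0 : ℝ) t) : (jumpPath t a ω).1 s = gridRep β S n (jumpSum t a ω s) := rfl

variable [MeasurableSpace K] [BorelSpace K]

/-- No measurability of `f` is needed: the sum depends only on the jumps and on which of them are
counted, so the map factors through a finite discrete space. -/
theorem measurable_comp_jumpSum {E : Type*} [MeasurableSpace E] {k : ℕ} (t : ℝ) (a : K) (s : ℝ)
    (f : K → E) : Measurable fun ω : Fin k → ℝ × grid β S n => f (jumpSum t a ω s) := by
  classical
  let g : (Fin k → Bool × grid β S n) → E := fun η => f (a + ∑ j, if (η j).1 then ((η j).2 : K) else 0)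
  let φ : (Fin k → ℝ × grid β S n) → (Fin k → Bool × grid β S n) := fun ω j =>
    (decide (0 < (ω j).1 ∧ (ω j).1 < t ∧ (ω j).1 ≤ s), (ω j).2)
  have hφ : Measurable φ := by
    refine measurable_pi_lambda _ fun j => Measurable.prodMk ?_ (by fun_prop)
    refine measurable_to_bool ?_
    have : (fun ω : Fin k → ℝ × grid β S n =>
        decide (0 < (ω j).1 ∧ (ω j).1 < t ∧ (ω j).1 ≤ s)) ⁻¹' {true} =
        (fun ω => (ω j).1) ⁻¹' (Set.Ioo 0 t ∩ Set.Iic s) := by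
      ext ω
      simp [and_assoc]
    rw [this]
    exact (by fun_prop : Measurable fun ω : Fin k → ℝ × grid β S n => (ω j).1)
      (measurableSet_Ioo.inter measurableSet_Iic)
  have hg : Measurable g := Measurable.of_discrete
  convert hg.comp hφ using 1
  funext ω
  simp [g, φ, jumpSum]

theorem measurable_jumpPath {k : ℕ} (t : ℝ) (a : K) :
    Measurable fun ω : Fin k → ℝ × grid β S n => jumpPath t a ω := by
  refine Measurable.subtype_mk (measurable_pi_lambda _ fun s => ?_)
  exact measurable_comp_jumpSum t a s (gridRep β S n)

/-- The rate measure of the jumps. -/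
def jumpMeasure (β : K) (S : Finset K) (n : ℕ) (χ : AddChar K Circle) (α : ℝ) :
    Measure (grid β S n) :=
  Measure.sum fun z : grid β S n => ENNReal.ofReal (jumpWeight β S n χ α z) • Measure.dirac z

instance (α : ℝ) : IsFiniteMeasure (jumpMeasure β S n χ α) := by
  unfold jumpMeasure
  rw [Measure.sum_fintype]
  have (z : grid β S n) : IsFiniteMeasure
      (ENNReal.ofReal (jumpWeight β S n χ α z) • Measure.dirac z) :=
    Measure.smul_finite _ ENNReal.ofReal_ne_top
  infer_instance

theorem integral_jumpMeasure {α : ℝ} (hw : ∀ z ∈ grid β S n, 0 ≤ jumpWeight β S n χ α z)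
    (f : grid β S n → ℂ) : ∫ z, f z ∂(jumpMeasure β S n χ α) =
      ∑ z : grid β S n, (jumpWeight β S n χ α z : ℂ) * f z := by
  rw [jumpMeasure, Measure.sum_fintype, integral_finsetSum_measure]
  · refine Finset.sum_congr rfl fun z _ => ?_
    rw [integral_smul_measure, integral_dirac, ENNReal.toReal_ofReal (hw z z.2)]
    simp
  · intro z _
    exact (integrable_dirac (by simp)).smul_measure ENNReal.ofReal_ne_top

/-- The intensity measure of the times and sizes of the jumps on `[0,t]`. -/
def intensity (β : K) (S : Finset K) (n : ℕ) (χ : AddChar K Circle) (α t : ℝ) :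
    Measure (ℝ × grid β S n) :=
  (volume.restrict (Set.Ioo 0 t)).prod (jumpMeasure β S n χ α)

instance (α t : ℝ) : IsFiniteMeasure (intensity β S n χ α t) := by
  unfold intensity
  infer_instance

/-- The law of the compound Poisson process on `X_n` that starts at `a`. -/
def poissonLaw (β : K) (S : Finset K) (n : ℕ) (χ : AddChar K Circle) (α t : ℝ) (a : K) :
    Measure (skorokhod K t) :=
  ENNReal.ofReal (Real.exp (-(jumpRate β S n α * t))) • Measure.sum fun k : ℕ =>
    ENNReal.ofReal ((k.factorial : ℝ)⁻¹) •
      (Measure.pi fun _ : Fin k => intensity β S n χ α t).map (jumpPath t a)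

theorem poissonLaw_real {α t : ℝ} {a : K} {A : Set (skorokhod K t)} (hA : MeasurableSet A) :
    (poissonLaw β S n χ α t a).real A = Real.exp (-(jumpRate β S n α * t)) *
      ∑' k : ℕ, (k.factorial : ℝ)⁻¹ *
        (Measure.pi fun _ : Fin k => intensity β S n χ α t).real (jumpPath t a ⁻¹' A) := by
  rw [Measure.real, poissonLaw, Measure.smul_apply, Measure.sum_apply _ hA, smul_eq_mul,
    ENNReal.toReal_mul, ENNReal.toReal_ofReal (Real.exp_nonneg _), ENNReal.tsum_toReal_eq]
  · congr 2
    funext k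
    rw [Measure.smul_apply, smul_eq_mul, ENNReal.toReal_mul,
      ENNReal.toReal_ofReal (by positivity), Measure.map_apply (measurable_jumpPath t a) hA]
    rfl
  · intro k
    rw [Measure.smul_apply, smul_eq_mul, Measure.map_apply (measurable_jumpPath t a) hA]
    exact ENNReal.mul_ne_top ENNReal.ofReal_ne_top (measure_ne_top _ _)

end JumpPaths

/-! ### Characters of the increments under the jump intensity -/

section Law

variable {K : Type*} [Field K] [ValuativeRel K] [TopologicalSpace K]
  [IsNonarchimedeanLocalField K] {β : K} {S : Finset K} {n : ℕ} {χ : AddChar K Circle}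

/-- The contribution of one jump to the characters `ξ i` of the increments of the path over the
intervals `(T i, T (i+1)]`. -/
def jumpChar (χ : AddChar K Circle) (t : ℝ) {N : ℕ} (T : Fin (N + 1) → ℝ) (ξ : Fin N → K)
    (p : ℝ × grid β S n) : ℂ :=
  open Classical in
  ∏ i : Fin N, (χ (-(if p.1 ∈ Set.Ioo 0 t ∩ Set.Ioc (T i.castSucc) (T i.succ) then (p.2 : K)
    else 0) * ξ i) : ℂ)

theorem char_sum {ι : Type*} (s : Finset ι) (f : ι → K) :
    (χ (∑ i ∈ s, f i) : ℂ) = ∏ i ∈ s, (χ (f i) : ℂ) := by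
  classical
  induction s using Finset.induction_on with
  | empty => simp
  | insert a s ha ih =>
    rw [Finset.sum_insert ha, Finset.prod_insert ha, AddChar.map_add_eq_mul, Circle.coe_mul, ih]

/-- An increment is a sum of jumps, so its characters are products over the jumps. In this form the
integral over independent jumps factorises. -/
theorem prod_char_increments {t : ℝ} {a : K} {N k : ℕ} {T : Fin (N + 1) → ℝ} (hT : Monotone T)
    (ξ : Fin N → K) (ω : Fin k → ℝ × grid β S n) :
    ∏ i : Fin N, (χ (-(jumpSum t a ω (T i.succ) - jumpSum t a ω (T i.castSucc)) * ξ i) : ℂ) =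
      ∏ j, jumpChar χ t T ξ (ω j) := by
  classical
  simp only [jumpChar]
  rw [Finset.prod_comm]
  refine Finset.prod_congr rfl fun i _ => ?_
  rw [jumpSum_sub t a ω (hT (Fin.castSucc_lt_succ).le), ← Finset.sum_neg_distrib,
    Finset.sum_mul, char_sum]

theorem index_eq_of_mem_Ioc {N : ℕ} {T : Fin (N + 1) → ℝ} (hT : Monotone T) {u : ℝ} {i j : Fin N}
    (hi : u ∈ Set.Ioc (T i.castSucc) (T i.succ)) (hj : u ∈ Set.Ioc (T j.castSucc) (T j.succ)) :
    j = i := by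
  by_contra hne
  rcases lt_or_gt_of_ne hne with h | h
  · have : T j.succ ≤ T i.castSucc := hT (by simpa [Fin.le_iff_val_le_val] using h)
    exact absurd (hj.2.trans this) (not_le.2 hi.1)
  · have : T i.succ ≤ T j.castSucc := hT (by simpa [Fin.le_iff_val_le_val] using h)
    exact absurd (hi.2.trans this) (not_le.2 hj.1)

variable [MeasurableSpace K] [BorelSpace K]

/-- The case `η = 0` of the inversion formula, where `|0|^α = 0` because `α > 0`. -/
theorem sum_jumpWeight (hβ : IsUniformizer β) (hS : IsResidueSystem S)
    (hχ : HasRankZero β χ) {α : ℝ} (hα : 0 < α) :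
    ∑ z : grid β S n, (jumpWeight β S n χ α z : ℂ) = jumpRate β S n α := by
  have := sum_jumpWeight_mul_char hβ hS hχ hα (zero_mem_grid hS (n := n))
  simp only [zero_mul, neg_zero, AddChar.map_zero_eq_one, Circle.coe_one, mul_one] at this
  rw [Finset.sum_coe_sort (grid β S n) fun z => (jumpWeight β S n χ α z : ℂ), this]
  simp [canonicalAbs, Real.zero_rpow hα.ne']

/-- The intervals are disjoint, so a jump at time `u` is seen by at most one of the characters, and
the inversion formula applies to that one. -/
theorem sum_jumpWeight_mul_jumpChar (hβ : IsUniformizer β) (hS : IsResidueSystem S)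
    (hχ : HasRankZero β χ) {α : ℝ} (hα : 0 < α) {t : ℝ} {N : ℕ} {T : Fin (N + 1) → ℝ}
    (hT : Monotone T) {ξ : Fin N → K} (hξ : ∀ i, ξ i ∈ grid β S n) {u : ℝ}
    (hu : u ∈ Set.Ioo 0 t) :
    ∑ z : grid β S n, (jumpWeight β S n χ α z : ℂ) * jumpChar χ t T ξ (u, z) =
      ((jumpRate β S n α - ∑ i, (Set.Ioc (T i.castSucc) (T i.succ)).indicator
        (fun _ => canonicalAbs (ξ i) ^ α) u : ℝ) : ℂ) := by
  classical
  by_cases h : ∃ i : Fin N, u ∈ Set.Ioc (T i.castSucc) (T i.succ)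
  · obtain ⟨i, hi⟩ := h
    have hne {j : Fin N} (hj : j ≠ i) : u ∉ Set.Ioc (T j.castSucc) (T j.succ) :=
      fun hj' => hj (index_eq_of_mem_Ioc hT hi hj')
    have h1 (z : grid β S n) : jumpChar χ t T ξ (u, z) = (χ (-(ξ i * z)) : ℂ) := by
      rw [jumpChar, Finset.prod_eq_single i]
      · rw [if_pos ⟨hu, hi⟩]
        congr 2
        ring
      · intro j _ hj
        rw [if_neg fun h => hne hj h.2]
        simp
      · simp
    simp only [h1]
    rw [Finset.sum_coe_sort (grid β S n)
      fun z => (jumpWeight β S n χ α z : ℂ) * (χ (-(ξ i * z)) : ℂ),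
      sum_jumpWeight_mul_char hβ hS hχ hα (hξ i), Finset.sum_eq_single i,
      Set.indicator_of_mem hi]
    · intro j _ hj
      rw [Set.indicator_of_notMem (hne hj)]
    · simp
  · push Not at h
    have h1 (z : grid β S n) : jumpChar χ t T ξ (u, z) = 1 := by
      refine Finset.prod_eq_one fun i _ => ?_
      rw [if_neg fun h' => h i h'.2]
      simp
    simp only [h1, mul_one]
    rw [sum_jumpWeight hβ hS hχ hα, Finset.sum_eq_zero, sub_zero]
    intro i _
    exact Set.indicator_of_notMem (h i) _

theorem measurable_jumpChar (t : ℝ) {N : ℕ} (T : Fin (N + 1) → ℝ) (ξ : Fin N → K) :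
    Measurable (jumpChar χ t T ξ : ℝ × grid β S n → ℂ) := by
  classical
  refine Finset.measurable_fun_prod _ fun i _ => ?_
  have e (p : ℝ × grid β S n) : (χ (-(if p.1 ∈ Set.Ioo 0 t ∩ Set.Ioc (T i.castSucc) (T i.succ)
      then (p.2 : K) else 0) * ξ i) : ℂ) =
      if p.1 ∈ Set.Ioo 0 t ∩ Set.Ioc (T i.castSucc) (T i.succ) then (χ (-(p.2 : K) * ξ i) : ℂ)
      else 1 := by
    split_ifs <;> simp
  simp only [e]
  refine Measurable.ite ?_ ?_ measurable_const
  · exact measurable_fst (measurableSet_Ioo.inter measurableSet_Ioc)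
  · exact (Measurable.of_discrete (f := fun z : grid β S n => (χ (-(z : K) * ξ i) : ℂ))).comp
      measurable_snd

theorem integrable_jumpChar (α t : ℝ) {N : ℕ} (T : Fin (N + 1) → ℝ) (ξ : Fin N → K) :
    Integrable (jumpChar χ t T ξ) (intensity β S n χ α t) := by
  refine Integrable.of_bound (measurable_jumpChar t T ξ).aestronglyMeasurable 1
    (Eventually.of_forall fun p => ?_)
  rw [jumpChar, norm_prod]
  exact (Finset.prod_eq_one fun i _ => Circle.norm_coe _).le

theorem integral_jumpChar (hβ : IsUniformizer β) (hS : IsResidueSystem S)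
    (hχ : HasRankZero β χ) {α : ℝ} (hα : 0 < α) {t : ℝ} (ht : 0 ≤ t) {N : ℕ}
    {T : Fin (N + 1) → ℝ} (hT : Monotone T) (hT0 : ∀ i, T i ∈ Set.Icc 0 t) {ξ : Fin N → K}
    (hξ : ∀ i, ξ i ∈ grid β S n) :
    ∫ p, jumpChar χ t T ξ p ∂(intensity β S n χ α t) =
      ((jumpRate β S n α * t - ∑ i : Fin N, (T i.succ - T i.castSucc) *
        canonicalAbs (ξ i) ^ α : ℝ) : ℂ) := by
  have hI := integrable_jumpChar (β := β) (S := S) (n := n) (χ := χ) α t T ξ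
  rw [intensity] at hI ⊢
  rw [integral_prod _ hI]
  have h1 : ∀ u ∈ Set.Ioo 0 t, ∫ z, jumpChar χ t T ξ (u, z) ∂(jumpMeasure β S n χ α) =
      ((jumpRate β S n α - ∑ i, (Set.Ioc (T i.castSucc) (T i.succ)).indicator
        (fun _ => canonicalAbs (ξ i) ^ α) u : ℝ) : ℂ) := by
    intro u hu
    rw [integral_jumpMeasure fun z hz => (jumpWeight_spec hβ hS hχ hα hz).1,
      sum_jumpWeight_mul_jumpChar hβ hS hχ hα hT hξ hu]
  rw [setIntegral_congr_fun measurableSet_Ioo h1, integral_complex_ofReal]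
  congr 1
  have hint (i : Fin N) : Integrable ((Set.Ioc (T i.castSucc) (T i.succ)).indicator
      fun _ => canonicalAbs (ξ i) ^ α) (volume.restrict (Set.Ioo 0 t)) :=
    (integrable_const _).indicator measurableSet_Ioc
  rw [integral_sub (integrable_const _) (integrable_finsetSum _ fun i _ => hint i),
    integral_finsetSum _ fun i _ => hint i, setIntegral_const, Real.volume_real_Ioo_of_le ht]
  congr 1
  · simp [mul_comm]
  · refine Finset.sum_congr rfl fun i _ => ?_
    rw [setIntegral_indicator measurableSet_Ioc, setIntegral_const, smul_eq_mul]
    congr 1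
    -- The jump times omit `t`, a null set, whereas the last interval may contain it.
    have e : volume.real (Set.Ioo 0 t ∩ Set.Ioc (T i.castSucc) (T i.succ)) =
        volume.real (Set.Ioc 0 t ∩ Set.Ioc (T i.castSucc) (T i.succ)) :=
      measureReal_congr (Ioo_ae_eq_Ioc.inter (ae_eq_refl _))
    rw [e, Set.inter_eq_right.2 (Set.Ioc_subset_Ioc (hT0 _).1 (hT0 _).2),
      Real.volume_real_Ioc_of_le (hT Fin.castSucc_lt_succ.le)]

/-- The event that the path visits the points `b i` at the times `T (i+1)`, in terms of the
increments of the jump sum. -/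
theorem gridRep_jumpSum_eq_iff (hβ : IsUniformizer β) (hS : IsResidueSystem S) {t : ℝ} {a : K}
    (ha : a ∈ grid β S n) {N k : ℕ} {T : Fin (N + 1) → ℝ} (hT0 : T 0 = 0) {b : Fin N → K}
    (hb : ∀ i, b i ∈ grid β S n) (ω : Fin k → ℝ × grid β S n) :
    (∀ i : Fin N, gridRep β S n (jumpSum t a ω (T i.succ)) = b i) ↔
      ∀ i : Fin N, (b i - (Fin.cons a b : Fin (N + 1) → K) i.castSucc) -
        (jumpSum t a ω (T i.succ) - jumpSum t a ω (T i.castSucc)) ∈ ball β (-(n : ℤ)) := by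
  -- `d` is the deviation of the jump sum from the prescribed points. It starts at `0`, so all its
  -- values lie in the subgroup `B_{-n}` exactly when all its successive differences do.
  set d : Fin (N + 1) → K := fun i => jumpSum t a ω (T i) - (Fin.cons a b : Fin (N + 1) → K) i
    with hd
  have hd0 : d 0 = 0 := by simp [hd, hT0, jumpSum_zero]
  have h1 (i : Fin N) : gridRep β S n (jumpSum t a ω (T i.succ)) = b i ↔
      d i.succ ∈ ball β (-(n : ℤ)) := by
    rw [gridRep_eq_iff hβ hS (jumpSum_mem_ball hβ hS t ha ω _) (hb i)]
    simp [hd]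
  have h2 (i : Fin N) : (b i - (Fin.cons a b : Fin (N + 1) → K) i.castSucc) -
        (jumpSum t a ω (T i.succ) - jumpSum t a ω (T i.castSucc)) =
      d i.castSucc - d i.succ := by
    simp only [hd, Fin.cons_succ]
    ring
  simp only [h1, h2]
  constructor
  · intro h i
    have h3 : ∀ j, d j ∈ ball β (-(n : ℤ)) :=
      Fin.cases (by rw [hd0]; exact zero_mem_ball _) h
    exact sub_mem_ball (h3 _) (h3 _)
  · intro h
    have h3 : ∀ j, d j ∈ ball β (-(n : ℤ)) := by
      refine Fin.induction (by rw [hd0]; exact zero_mem_ball _) fun i hi => ?_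
      have := sub_mem_ball hi (h i)
      rwa [sub_sub_cancel] at this
    exact fun i => h3 _

/-- Each of the `N` congruences modulo `B_{-n}` is detected by the normalised sum of all characters;
multiplying out the product gives one frequency `ξ i` per increment. -/
theorem indicator_path_eq (hβ : IsUniformizer β) (hS : IsResidueSystem S)
    (hχ : HasRankZero β χ) {t : ℝ} {a : K} (ha : a ∈ grid β S n) {N k : ℕ}
    {T : Fin (N + 1) → ℝ} (hT : Monotone T) (hT0 : T 0 = 0) {b : Fin N → K}
    (hb : ∀ i, b i ∈ grid β S n) (ω : Fin k → ℝ × grid β S n)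
    [Decidable (∀ i : Fin N, gridRep β S n (jumpSum t a ω (T i.succ)) = b i)] :
    (if ∀ i : Fin N, gridRep β S n (jumpSum t a ω (T i.succ)) = b i then (1 : ℂ) else 0) =
      ∑ ξ ∈ Fintype.piFinset fun _ : Fin N => grid β S n,
        (∏ i, (((residueCard K : ℂ) ^ (2 * n))⁻¹ *
          (χ ((b i - (Fin.cons a b : Fin (N + 1) → K) i.castSucc) * ξ i) : ℂ))) *
        ∏ j, jumpChar χ t T ξ (ω j) := by
  classical
  have hq : (residueCard K : ℂ) ≠ 0 := Nat.cast_ne_zero.2 hS.residueCard_pos.ne'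
  set D : Fin N → K := fun i => (b i - (Fin.cons a b : Fin (N + 1) → K) i.castSucc) -
        (jumpSum t a ω (T i.succ) - jumpSum t a ω (T i.castSucc)) with hD
  have hcons : ∀ j, (Fin.cons a b : Fin (N + 1) → K) j ∈ grid β S n := Fin.cases ha hb
  have hDb (i : Fin N) : D i ∈ ball β n :=
    sub_mem_ball (sub_mem_ball (mem_ball_of_mem_grid hβ hS (hb i))
      (mem_ball_of_mem_grid hβ hS (hcons _)))
      (sub_mem_ball (jumpSum_mem_ball hβ hS t ha ω _) (jumpSum_mem_ball hβ hS t ha ω _))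
  have h1 : (if ∀ i : Fin N, gridRep β S n (jumpSum t a ω (T i.succ)) = b i then (1 : ℂ) else 0) =
      ∏ i, if D i ∈ ball β (-(n : ℤ)) then (1 : ℂ) else 0 := by
    simp only [gridRep_jumpSum_eq_iff hβ hS ha hT0 hb ω]
    rw [Finset.prod_ite_zero]
    simp [hD]
  have h2 (i : Fin N) : (if D i ∈ ball β (-(n : ℤ)) then (1 : ℂ) else 0) =
      ∑ η ∈ grid β S n, ((residueCard K : ℂ) ^ (2 * n))⁻¹ * (χ (D i * η) : ℂ) := by
    rw [← Finset.mul_sum, sum_char_grid hβ hS hχ (hDb i)]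
    split_ifs
    · field_simp
    · simp
  rw [h1, Finset.prod_congr rfl fun i _ => h2 i, Finset.prod_univ_sum]
  refine Finset.sum_congr rfl fun ξ _ => ?_
  rw [← prod_char_increments (a := a) hT, ← Finset.prod_mul_distrib]
  refine Finset.prod_congr rfl fun i _ => ?_
  rw [mul_assoc, ← Circle.coe_mul, ← AddChar.map_add_eq_mul, ← add_mul, ← sub_eq_add_neg]

end Law

/-! ### Existence and uniqueness of the path measure -/

section Law

variable {K : Type*} [Field K] [ValuativeRel K] [TopologicalSpace K]
  [IsNonarchimedeanLocalField K] {β : K} {S : Finset K} {n : ℕ} {χ : AddChar K Circle}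
  [MeasurableSpace K] [BorelSpace K]

theorem measurableSet_cylinder {t : ℝ} {N : ℕ} (τ : Fin N → Set.Icc (0 : ℝ) t) {J : Fin N → Set K}
    (hJ : ∀ i, MeasurableSet (J i)) :
    MeasurableSet {ω : skorokhod K t | ∀ i, ω.1 (τ i) ∈ J i} := by
  have : {ω : skorokhod K t | ∀ i, ω.1 (τ i) ∈ J i} =
      ⋂ i, (fun ω : skorokhod K t => ω.1 (τ i)) ⁻¹' J i := by
    ext; simp
  rw [this]
  exact MeasurableSet.iInter fun i =>
    ((measurable_pi_apply (τ i)).comp measurable_subtype_coe) (hJ i)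

/-- After the expansion in characters every term is a product of one function over the `k` jumps,
and its integral against the product measure is a `k`-th power. -/
theorem pi_intensity_cylinder (hβ : IsUniformizer β) (hS : IsResidueSystem S)
    (hχ : HasRankZero β χ) (α : ℝ) {t : ℝ} {a : K} (ha : a ∈ grid β S n) {N : ℕ} (k : ℕ)
    {τ : Fin N → Set.Icc (0 : ℝ) t} {T : Fin (N + 1) → ℝ} (hTτ : ∀ i, T i.succ = τ i)
    (hT : Monotone T) (hT0 : T 0 = 0) {J : Fin N → Set K} (hJ : ∀ i, MeasurableSet (J i)) :
    (((Measure.pi fun _ : Fin k => intensity β S n χ α t).real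
      (jumpPath t a ⁻¹' {ω | ∀ i, ω.1 (τ i) ∈ J i}) : ℝ) : ℂ) =
      open Classical in
      ∑ b ∈ Fintype.piFinset (fun i => (grid β S n).filter (· ∈ J i)),
        ∑ ξ ∈ Fintype.piFinset fun _ : Fin N => grid β S n,
        (∏ i, (((residueCard K : ℂ) ^ (2 * n))⁻¹ *
          (χ ((b i - (Fin.cons a b : Fin (N + 1) → K) i.castSucc) * ξ i) : ℂ))) *
        (∫ p, jumpChar χ t T ξ p ∂(intensity β S n χ α t)) ^ k := by
  classical
  set A := jumpPath (β := β) (S := S) (n := n) (k := k) t a ⁻¹' {ω | ∀ i, ω.1 (τ i) ∈ J i} with hA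
  have hAm : MeasurableSet A := measurable_jumpPath t a (measurableSet_cylinder τ hJ)
  have h0 : (((Measure.pi fun _ : Fin k => intensity β S n χ α t).real A : ℝ) : ℂ) =
      ∫ ω, A.indicator (fun _ => (1 : ℂ)) ω
        ∂(Measure.pi fun _ : Fin k => intensity β S n χ α t) := by
    rw [integral_indicator hAm, setIntegral_const]
    simp
  have h1 (ω : Fin k → ℝ × grid β S n) : A.indicator (fun _ => (1 : ℂ)) ω =
      ∑ b ∈ Fintype.piFinset (fun i => (grid β S n).filter (· ∈ J i)),
        if ∀ i : Fin N, gridRep β S n (jumpSum t a ω (T i.succ)) = b i then (1 : ℂ) else 0 := by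
    simp only [← funext_iff (f := fun i : Fin N => gridRep β S n (jumpSum t a ω (T i.succ)))]
    rw [Finset.sum_ite_eq, Set.indicator_apply]
    congr 1
    rw [eq_iff_iff, Fintype.mem_piFinset]
    refine forall_congr' fun i => ?_
    rw [Finset.mem_filter, hTτ, jumpPath_apply]
    exact ⟨fun h => ⟨gridRep_mem hS _, h⟩, fun h => h.2⟩
  have hint (ξ : Fin N → K) : Integrable (fun ω : Fin k → ℝ × grid β S n =>
      ∏ j, jumpChar χ t T ξ (ω j)) (Measure.pi fun _ : Fin k => intensity β S n χ α t) :=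
    Integrable.fintype_prod (f := fun _ => jumpChar χ t T ξ) fun _ => integrable_jumpChar α t T ξ
  rw [h0]
  simp only [h1]
  have h2 : ∀ b ∈ Fintype.piFinset (fun i => (grid β S n).filter (· ∈ J i)), ∀ i,
      b i ∈ grid β S n := fun b hb i =>
    (Finset.mem_filter.1 (Fintype.mem_piFinset.1 hb i)).1
  rw [integral_congr_ae (Eventually.of_forall fun ω => Finset.sum_congr rfl fun b hb =>
    indicator_path_eq hβ hS hχ ha hT hT0 (h2 b hb) ω)]
  rw [integral_finsetSum]
  · refine Finset.sum_congr rfl fun b _ => ?_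
    rw [integral_finsetSum]
    · refine Finset.sum_congr rfl fun ξ _ => ?_
      rw [integral_const_mul, integral_fintype_prod_eq_pow]
      simp
    · exact fun ξ _ => (hint ξ).const_mul _
  · exact fun b _ => integrable_finsetSum _ fun ξ _ => (hint ξ).const_mul _

theorem poissonLaw_cylinder (hβ : IsUniformizer β) (hS : IsResidueSystem S)
    (hχ : HasRankZero β χ) {α : ℝ} (hα : 0 < α) {t : ℝ} (ht : 0 ≤ t) {a : K}
    (ha : a ∈ grid β S n) {N : ℕ} {τ : Fin N → Set.Icc (0 : ℝ) t} (hτ : StrictMono τ)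
    {J : Fin N → Set K} (hJ : ∀ i, MeasurableSet (J i)) :
    (((poissonLaw β S n χ α t a).real {ω | ∀ i, ω.1 (τ i) ∈ J i} : ℝ) : ℂ) =
      open Classical in
      ∑ b ∈ Fintype.piFinset (fun i => (grid β S n).filter (· ∈ J i)),
          (∏ i : Fin N, density β S n χ α
            ((τ i : ℝ) - (Fin.cons 0 (fun j => (τ j : ℝ)) : Fin (N + 1) → ℝ) i.castSucc)
            (b i - (Fin.cons a b : Fin (N + 1) → K) i.castSucc)) *
          ((residueCard K : ℂ) ^ (n * N))⁻¹ := by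
  classical
  have hq : (residueCard K : ℂ) ≠ 0 := Nat.cast_ne_zero.2 hS.residueCard_pos.ne'
  set T : Fin (N + 1) → ℝ := Fin.cons 0 (fun j => (τ j : ℝ)) with hTdef
  have hTs (i : Fin N) : T i.succ = τ i := by simp [hTdef]
  have hT0 : T 0 = 0 := by simp [hTdef]
  have hTm : ∀ i, T i ∈ Set.Icc 0 t :=
    Fin.cases (by rw [hT0]; exact ⟨le_rfl, ht⟩) fun i => by rw [hTs]; exact (τ i).2
  have hT : Monotone T := by
    intro i j
    refine Fin.cases (fun _ => ?_) (fun i => ?_) i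
    · rw [hT0]; exact (hTm j).1
    · refine Fin.cases (fun h => ?_) (fun j h => ?_) j
      · exact absurd h (by simp)
      · rw [hTs, hTs]
        exact hτ.monotone (by simpa using h)
  rw [poissonLaw_real (measurableSet_cylinder τ hJ), Complex.ofReal_mul, Complex.ofReal_tsum]
  simp only [Complex.ofReal_mul, pi_intensity_cylinder hβ hS hχ α ha _ hTs hT hT0 hJ]
  set I : (Fin N → K) → ℂ := fun ξ => ∫ p, jumpChar χ t T ξ p ∂(intensity β S n χ α t) with hI
  set c : (Fin N → K) → (Fin N → K) → ℂ := fun b ξ =>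
    ∏ i, (((residueCard K : ℂ) ^ (2 * n))⁻¹ *
          (χ ((b i - (Fin.cons a b : Fin (N + 1) → K) i.castSucc) * ξ i) : ℂ)) with hc
  -- Summing over the number of jumps produces the exponential series of the one-jump integral `I
  -- ξ`.
  have hsum : HasSum (fun k : ℕ => (((k.factorial : ℝ)⁻¹ : ℝ) : ℂ) *
      ∑ b ∈ Fintype.piFinset (fun i => (grid β S n).filter (· ∈ J i)),
        ∑ ξ ∈ Fintype.piFinset fun _ : Fin N => grid β S n, c b ξ * I ξ ^ k)
      (∑ b ∈ Fintype.piFinset (fun i => (grid β S n).filter (· ∈ J i)),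
        ∑ ξ ∈ Fintype.piFinset fun _ : Fin N => grid β S n, c b ξ * Complex.exp (I ξ)) := by
    have := hasSum_sum (s := Fintype.piFinset (fun i => (grid β S n).filter (· ∈ J i)))
      fun b (_ : b ∈ _) => hasSum_sum (s := Fintype.piFinset fun _ : Fin N => grid β S n)
        fun ξ (_ : ξ ∈ _) => (NormedSpace.expSeries_div_hasSum_exp (𝔸 := ℂ) (I ξ)).mul_left (c b ξ)
    rw [← Complex.exp_eq_exp_ℂ] at this
    refine Eq.mp (congrArg (fun f : ℕ → ℂ => HasSum f _) (funext fun k => Eq.symm ?_)) this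
    rw [Finset.mul_sum]
    refine Finset.sum_congr rfl fun b _ => ?_
    rw [Finset.mul_sum]
    refine Finset.sum_congr rfl fun ξ _ => ?_
    push_cast
    ring
  rw [hsum.tsum_eq, Finset.mul_sum]
  refine Finset.sum_congr rfl fun b _ => ?_
  simp only [density]
  rw [Finset.prod_mul_distrib, Finset.prod_univ_sum, Finset.mul_sum, Finset.mul_sum,
    Finset.sum_mul]
  refine Finset.sum_congr rfl fun ξ hξ => ?_
  have hξ' : ∀ i, ξ i ∈ grid β S n := Fintype.mem_piFinset.1 hξ
  have hIξ : I ξ = _ := integral_jumpChar hβ hS hχ hα ht hT hTm hξ'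
  -- The normalisation `e^{-Ct}` cancels the term `Ct` of `I ξ`, leaving the exponents of the
  -- densities.
  have hexp : ((Real.exp (-(jumpRate β S n α * t)) : ℝ) : ℂ) * Complex.exp (I ξ) =
      ∏ i : Fin N, ((Real.exp (-(τ i - T i.castSucc) * canonicalAbs (ξ i) ^ α) : ℝ) : ℂ) := by
    rw [hIξ, ← Complex.ofReal_exp, ← Complex.ofReal_mul, ← Real.exp_add, ← Complex.ofReal_prod,
      ← Real.exp_sum]
    congr 2
    simp only [hTs, neg_mul, Finset.sum_neg_distrib]
    ring
  rw [mul_left_comm, hexp, hc]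
  simp only [Finset.prod_mul_distrib, Finset.prod_const, Finset.card_univ, Fintype.card_fin]
  -- Half of the factor `q^{-2nN}` belongs to the `N` densities, the other half is the mass of the
  -- `N` points.
  have : (((residueCard K : ℂ) ^ (2 * n))⁻¹) ^ N =
      (((residueCard K : ℂ) ^ n)⁻¹) ^ N * ((residueCard K : ℂ) ^ (n * N))⁻¹ := by
    rw [two_mul, pow_add, mul_inv, mul_pow]
    congr 1
    rw [pow_mul, inv_pow]
  rw [this]
  push_cast
  ring

theorem isPathLaw_poissonLaw (hβ : IsUniformizer β) (hS : IsResidueSystem S)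
    (hχ : HasRankZero β χ) {α : ℝ} (hα : 0 < α) {t : ℝ} (ht : 0 ≤ t) {a : K}
    (ha : a ∈ grid β S n) : IsPathLaw β S n χ α t a (poissonLaw β S n χ α t a) := by
  have hcyl : ∀ (N : ℕ) (τ : Fin N → Set.Icc (0 : ℝ) t), StrictMono τ → ∀ J : Fin N → Set K,
      (∀ i, MeasurableSet (J i)) → _ := fun N τ hτ J hJ =>
    poissonLaw_cylinder hβ hS hχ hα ht ha hτ hJ
  refine ⟨⟨?_⟩, hcyl⟩
  -- For `N = 0` the cylinder is the whole space and its formula reads `1`.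
  have h := hcyl 0 Fin.elim0 (fun i => i.elim0) Fin.elim0 fun i => i.elim0
  have hu : {ω : skorokhod K t | ∀ i : Fin 0, ω.1 (i.elim0) ∈ (i.elim0 : Set K)} = Set.univ := by
    ext ω
    simp
  rw [hu] at h
  simp only [Finset.univ_eq_empty, Finset.prod_empty, mul_zero, pow_zero, inv_one, mul_one,
    Finset.sum_const, Fintype.card_piFinset] at h
  have h' : (poissonLaw β S n χ α t a).real Set.univ = 1 := by
    simpa using h
  exact (ENNReal.toReal_eq_one_iff _).1 h'

/-- Cylinders over finite sets of times form a π-system generating the σ-algebra. The prescribed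
formula covers increasing times only, so each finite set of times is enumerated in increasing order.
-/
theorem isPathLaw_unique {α t : ℝ} {a : K} {P Q : Measure (skorokhod K t)}
    (hP : IsPathLaw β S n χ α t a P) (hQ : IsPathLaw β S n χ α t a Q) : P = Q := by
  have := hP.isProbabilityMeasure
  have := hQ.isProbabilityMeasure
  set C := squareCylinders (α := fun _ : Set.Icc (0 : ℝ) t => K) fun _ => {s | MeasurableSet s}
  have hgen : (inferInstance : MeasurableSpace (skorokhod K t)) =
      MeasurableSpace.generateFrom (Set.preimage (Subtype.val) '' C) := by
    rw [← MeasurableSpace.comap_generateFrom, generateFrom_squareCylinders]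
    rfl
  refine ext_of_generate_finite _ hgen ?_ ?_ (by simp)
  · refine IsPiSystem.comap ?_ _
    exact isPiSystem_squareCylinders (fun _ => MeasurableSpace.isPiSystem_measurableSet)
      fun _ => MeasurableSet.univ
  · rintro _ ⟨_, ⟨s, J, hJ, rfl⟩, rfl⟩
    have hJ' : ∀ i, MeasurableSet (J i) := by simpa using hJ
    have key (R : Measure (skorokhod K t)) :
        R (Subtype.val ⁻¹' (s : Set (Set.Icc (0 : ℝ) t)).pi J) =
        R {ω | ∀ i : Fin s.card, ω.1 (s.orderEmbOfFin rfl i) ∈ J (s.orderEmbOfFin rfl i)} := by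
      congr 1
      ext ω
      simp only [Set.mem_preimage, Set.mem_pi, Finset.mem_coe, Set.mem_ofPred_eq]
      constructor
      · exact fun h i => h _ (Finset.orderEmbOfFin_mem s rfl i)
      · intro h i hi
        have : i ∈ Set.range (s.orderEmbOfFin rfl) := by
          rw [Finset.range_orderEmbOfFin]; exact hi
        obtain ⟨j, rfl⟩ := this
        exact h j
    change P (Subtype.val ⁻¹' (s : Set (Set.Icc (0 : ℝ) t)).pi J) =
      Q (Subtype.val ⁻¹' (s : Set (Set.Icc (0 : ℝ) t)).pi J)
    rw [key, key]
    refine (measureReal_eq_measureReal_iff).1 (Complex.ofReal_injective ?_)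
    rw [hP.cylinder _ _ (s.orderEmbOfFin rfl).strictMono _ fun i => hJ' _,
      hQ.cylinder _ _ (s.orderEmbOfFin rfl).strictMono _ fun i => hJ' _]

theorem existsUnique_isPathLaw (hβ : IsUniformizer β) (hS : IsResidueSystem S)
    (hχ : HasRankZero β χ) {α : ℝ} (hα : 0 < α) {t : ℝ} (ht : 0 ≤ t) {a : K}
    (ha : a ∈ grid β S n) : ∃! P : Measure (skorokhod K t), IsPathLaw β S n χ α t a P :=
  ⟨_, isPathLaw_poissonLaw hβ hS hχ hα ht ha, fun _ hQ =>
    isPathLaw_unique hQ (isPathLaw_poissonLaw hβ hS hχ hα ht ha)⟩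

theorem isPathLaw_pathMeasure (hβ : IsUniformizer β) (hS : IsResidueSystem S)
    (hχ : HasRankZero β χ) {α : ℝ} (hα : 0 < α) {t : ℝ} (ht : 0 ≤ t) {a : K}
    (ha : a ∈ grid β S n) : IsPathLaw β S n χ α t a (pathMeasure β S n χ α t a) := by
  have h := (existsUnique_isPathLaw hβ hS hχ hα ht ha).exists
  rw [pathMeasure, dif_pos h]
  exact h.choose_spec

end Law

/-! ### The Lie–Trotter product formula -/

section Trotter

variable {A : Type*} [NormedRing A] [NormOneClass A] [NormedAlgebra ℂ A] [CompleteSpace A]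

/-- Telescoping, one factor at a time. The assumption `1 ≤ r` permits the crude power `r ^ m`, with
which the induction closes. -/
theorem norm_pow_sub_pow_le {a b : A} {r : ℝ} (hr : 1 ≤ r) (ha : ‖a‖ ≤ r) (hb : ‖b‖ ≤ r)
    (m : ℕ) : ‖a ^ m - b ^ m‖ ≤ m * r ^ m * ‖a - b‖ := by
  have h0 : 0 ≤ r := zero_le_one.trans hr
  induction m with
  | zero => simp
  | succ m ih =>
    have e : a ^ (m + 1) - b ^ (m + 1) = a ^ m * (a - b) + (a ^ m - b ^ m) * b := by
      rw [pow_succ, pow_succ]; noncomm_ring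
    have h1 : ‖a ^ m‖ ≤ r ^ (m + 1) := (norm_pow_le a m).trans
      ((pow_le_pow_left₀ (norm_nonneg _) ha m).trans (pow_le_pow_right₀ hr (Nat.le_succ m)))
    rw [e]
    calc ‖a ^ m * (a - b) + (a ^ m - b ^ m) * b‖
        ≤ ‖a ^ m‖ * ‖a - b‖ + ‖a ^ m - b ^ m‖ * ‖b‖ :=
          (norm_add_le _ _).trans (add_le_add (norm_mul_le _ _) (norm_mul_le _ _))
      _ ≤ r ^ (m + 1) * ‖a - b‖ + (m * r ^ m * ‖a - b‖) * r := by
          gcongr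
      _ = ((m + 1 : ℕ) : ℝ) * r ^ (m + 1) * ‖a - b‖ := by push_cast; ring

theorem norm_exp_le (x : A) : ‖NormedSpace.exp x‖ ≤ Real.exp ‖x‖ := by
  have h1 := NormedSpace.exp_series_hasSum_exp' (𝕂 := ℂ) x
  have h2 := NormedSpace.expSeries_div_hasSum_exp (𝔸 := ℝ) ‖x‖
  rw [← Real.exp_eq_exp_ℝ] at h2
  rw [← h1.tsum_eq]
  refine tsum_of_norm_bounded h2 fun k => ?_
  rw [norm_smul, norm_inv, Complex.norm_natCast, div_eq_inv_mul]
  gcongr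
  exact norm_pow_le x k

/-- The Lie–Trotter product formula in a Banach algebra. -/
theorem tendsto_trotter (X Y : A) :
    Tendsto (fun m : ℕ => (NormedSpace.exp ((m : ℂ)⁻¹ • X) * NormedSpace.exp ((m : ℂ)⁻¹ • Y)) ^ m)
      atTop (𝓝 (NormedSpace.exp (X + Y))) := by
  let _ : NormedAlgebra ℚ A := NormedAlgebra.restrictScalars ℚ ℂ A
  -- The difference vanishes to first order at `0`, so at `z = 1/m` it is `o(1/m)`. This beats the
  -- factor `m` of `norm_pow_sub_pow_le`, while `r ^ m = exp (‖X‖ + ‖Y‖)` is independent of `m`.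
  have hd : HasDerivAt (fun z : ℂ => NormedSpace.exp (z • X) * NormedSpace.exp (z • Y) -
      NormedSpace.exp (z • (X + Y))) 0 0 := by
    have h1 := hasDerivAt_exp_smul_const (𝕂 := ℂ) X 0
    have h2 := hasDerivAt_exp_smul_const (𝕂 := ℂ) Y 0
    have h3 := hasDerivAt_exp_smul_const (𝕂 := ℂ) (X + Y) 0
    have := (h1.mul h2).sub h3
    refine HasDerivAt.congr_deriv (f := fun z : ℂ => NormedSpace.exp (z • X) *
      NormedSpace.exp (z • Y) - NormedSpace.exp (z • (X + Y))) this ?_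
    simp
  have hs : Tendsto (fun m : ℕ => ((m : ℂ)⁻¹)) atTop (𝓝[≠] 0) := by
    refine tendsto_nhdsWithin_iff.2 ⟨tendsto_inv_atTop_nhds_zero_nat (𝕜 := ℂ), ?_⟩
    filter_upwards [eventually_gt_atTop 0] with m hm
    simpa using hm.ne'
  have h0 := (hasDerivAt_iff_tendsto_slope_zero.1 hd).comp hs
  have hlim := ((h0.norm).const_mul (Real.exp (‖X‖ + ‖Y‖)))
  rw [tendsto_iff_norm_sub_tendsto_zero]
  refine squeeze_zero' (Eventually.of_forall fun m => norm_nonneg _) ?_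
    (by simpa using hlim)
  filter_upwards [eventually_gt_atTop 0] with m hm
  have hm' : (m : ℂ) ≠ 0 := by exact_mod_cast hm.ne'
  have e : NormedSpace.exp (X + Y) = NormedSpace.exp ((m : ℂ)⁻¹ • (X + Y)) ^ m := by
    rw [← NormedSpace.exp_nsmul, ← Nat.cast_smul_eq_nsmul ℂ, smul_smul, mul_inv_cancel₀ hm',
      one_smul]
  set r : ℝ := Real.exp ((‖X‖ + ‖Y‖) / m) with hr
  have hX : ‖(m : ℂ)⁻¹ • X‖ = ‖X‖ / m := by rw [norm_smul]; simp [div_eq_inv_mul]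
  have hY : ‖(m : ℂ)⁻¹ • Y‖ = ‖Y‖ / m := by rw [norm_smul]; simp [div_eq_inv_mul]
  have hXY : ‖(m : ℂ)⁻¹ • (X + Y)‖ ≤ (‖X‖ + ‖Y‖) / m := by
    rw [smul_add, add_div, ← hX, ← hY]
    exact norm_add_le _ _
  have ha : ‖NormedSpace.exp ((m : ℂ)⁻¹ • X) * NormedSpace.exp ((m : ℂ)⁻¹ • Y)‖ ≤ r := by
    rw [hr, add_div, Real.exp_add, ← hX, ← hY]
    exact (norm_mul_le _ _).trans (mul_le_mul (norm_exp_le _)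
      (norm_exp_le _) (norm_nonneg _) (Real.exp_nonneg _))
  have hb : ‖NormedSpace.exp ((m : ℂ)⁻¹ • (X + Y))‖ ≤ r :=
    (norm_exp_le _).trans (Real.exp_le_exp.2 hXY)
  have key := norm_pow_sub_pow_le (Real.one_le_exp (by positivity)) ha hb m
  rw [e]
  refine key.trans (le_of_eq ?_)
  have hrm : r ^ m = Real.exp (‖X‖ + ‖Y‖) := by
    rw [hr, ← Real.exp_nat_mul]
    congr 1
    field_simp
  rw [hrm]
  simp [norm_smul]
  ring

end Trotter

/-! ### Functional calculus of unitarily diagonalised operators -/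

section Diagonal

variable {E : Type*} [Fintype E] [DecidableEq E]

/-- The star algebra homomorphism which takes `g` to the conjugate by a unitary operator `U` of the
operator of multiplication by `g`. -/
def conjDiagonal (U : EuclideanSpace ℂ E →L[ℂ] EuclideanSpace ℂ E) (h : star U * U = 1)
    (h' : U * star U = 1) :
    (E → ℂ) →⋆ₐ[ℂ] (EuclideanSpace ℂ E →L[ℂ] EuclideanSpace ℂ E) where
  toFun g := star U * Matrix.toEuclideanCLM (n := E) (𝕜 := ℂ) (Matrix.diagonal g) * U
  map_one' := by
    rw [show Matrix.diagonal (1 : E → ℂ) = 1 from Matrix.diagonal_one, map_one, mul_one, h]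
  map_mul' f g := by
    have e : Matrix.diagonal (f * g) = Matrix.diagonal f * Matrix.diagonal g := by
      rw [Matrix.diagonal_mul_diagonal]; rfl
    rw [e, map_mul]
    set F := Matrix.toEuclideanCLM (n := E) (𝕜 := ℂ) (Matrix.diagonal f)
    set G := Matrix.toEuclideanCLM (n := E) (𝕜 := ℂ) (Matrix.diagonal g)
    calc star U * (F * G) * U = star U * F * 1 * G * U := by noncomm_ring
      _ = star U * F * U * (star U * G * U) := by rw [← h']; noncomm_ring
  map_zero' := by
    rw [show Matrix.diagonal (0 : E → ℂ) = 0 from Matrix.diagonal_zero, map_zero, mul_zero,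
      zero_mul]
  map_add' f g := by
    have e : Matrix.diagonal (f + g) = Matrix.diagonal f + Matrix.diagonal g := by
      rw [Matrix.diagonal_add]; rfl
    rw [e, map_add, mul_add, add_mul]
  commutes' c := by
    have e : Matrix.diagonal (algebraMap ℂ (E → ℂ) c) = algebraMap ℂ (Matrix E E ℂ) c := by
      rw [Matrix.algebraMap_eq_diagonal]
    rw [e, AlgHomClass.commutes, Algebra.algebraMap_eq_smul_one, mul_smul_comm, smul_mul_assoc,
      mul_one, h]
  map_star' g := by
    have e : Matrix.diagonal (star g) = star (Matrix.diagonal g) := by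
      rw [Matrix.star_eq_conjTranspose, Matrix.diagonal_conjTranspose]
    rw [e, map_star, star_mul, star_mul, star_star, mul_assoc]

variable {U : EuclideanSpace ℂ E →L[ℂ] EuclideanSpace ℂ E} (h : star U * U = 1)
  (h' : U * star U = 1)

theorem continuous_conjDiagonal : Continuous (conjDiagonal U h h') :=
  LinearMap.continuous_of_finiteDimensional
    ((conjDiagonal U h h').toAlgHom.toLinearMap)

/-- A continuous star homomorphism commutes with the functional calculus, which on `E → ℂ` acts
coordinatewise. Positivity of `α` keeps `x ↦ x ^ α` continuous at the eigenvalue `0`. -/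
theorem conjDiagonal_rpow {g : E → ℝ} (hg : ∀ x, 0 ≤ g x) {α : ℝ} (hα : 0 < α) :
    conjDiagonal U h h' (fun x => (g x : ℂ)) ^ α =
      conjDiagonal U h h' (fun x => ((g x ^ α : ℝ) : ℂ)) := by
  open scoped ComplexOrder in
  have h0 : (0 : E → ℂ) ≤ fun x => (g x : ℂ) := fun x => by
    simpa using hg x
  have hsa : IsSelfAdjoint (fun x => (g x : ℂ)) := by
    funext x
    simp
  have : ContinuousFunctionalCalculus ℝ (E → ℂ) IsSelfAdjoint :=
    IsSelfAdjoint.instContinuousFunctionalCalculus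
  have hc : Continuous fun x : ℝ => x ^ α := Real.continuous_rpow_const hα.le
  rw [CFC.rpow_eq_cfc_real (by exact map_nonneg (conjDiagonal U h h') h0),
    ← StarAlgHom.map_cfc (conjDiagonal U h h') (fun x : ℝ => x ^ α) _ hc.continuousOn
      (continuous_conjDiagonal h h') hsa (hsa.map _)]
  congr 1
  rw [cfc_map_pi (S := ℂ) (fun x : ℝ => x ^ α) (fun x => (g x : ℂ)) hc.continuousOn hsa
    (fun x => by simp [isSelfAdjoint_iff])]
  funext x
  exact cfc_algebraMap (A := ℂ) (g x) fun x : ℝ => x ^ α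

theorem exp_conjDiagonal (g : E → ℂ) :
    NormedSpace.exp (conjDiagonal U h h' g) = conjDiagonal U h h' (fun x => Complex.exp (g x)) := by
  rw [← NormedSpace.map_exp (conjDiagonal U h h') (continuous_conjDiagonal h h'), Pi.exp_def,
    Complex.exp_eq_exp_ℂ]

end Diagonal

/-! ### The finite Fourier transform and the two semigroups -/

section Operators

variable {K : Type*} [Field K] [ValuativeRel K] [TopologicalSpace K]
  [IsNonarchimedeanLocalField K] {β : K} {S : Finset K} {n : ℕ} {χ : AddChar K Circle}

theorem matrixOp_eq [DecidableEq (grid β S n)] (A : Matrix (grid β S n) (grid β S n) ℂ) :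
    matrixOp β S n A = Matrix.toEuclideanCLM (n := grid β S n) (𝕜 := ℂ) A := by
  unfold matrixOp
  congr!

theorem matrixOp_mul (A B : Matrix (grid β S n) (grid β S n) ℂ) :
    matrixOp β S n A * matrixOp β S n B = matrixOp β S n (A * B) := by
  classical
  simp only [matrixOp_eq, map_mul]

theorem star_matrixOp (A : Matrix (grid β S n) (grid β S n) ℂ) :
    star (matrixOp β S n A) = matrixOp β S n A.conjTranspose := by
  classical
  simp only [matrixOp_eq, ← Matrix.star_eq_conjTranspose, map_star]

theorem matrixOp_one [DecidableEq (grid β S n)] : matrixOp β S n 1 = 1 := by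
  simp only [matrixOp_eq, map_one]

theorem matrixOp_pow [DecidableEq (grid β S n)] (A : Matrix (grid β S n) (grid β S n) ℂ) (m : ℕ) :
    matrixOp β S n A ^ m = matrixOp β S n (A ^ m) := by
  simp only [matrixOp_eq, map_pow]

theorem matrixOp_apply (A : Matrix (grid β S n) (grid β S n) ℂ) (f : GridL2 β S n)
    (x : grid β S n) : matrixOp β S n A f x = (A.mulVec fun y => f y) x := rfl

theorem star_fourierOp : star (fourierOp β S n χ) = fourierInvOp β S n χ := by
  rw [fourierOp, star_matrixOp, fourierInvOp]
  congr 1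
  ext x y
  simp only [Matrix.conjTranspose_apply, Matrix.of_apply, star_mul', star_inv₀, star_pow,
    star_natCast]
  congr 1
  rw [AddChar.map_neg_eq_inv, Circle.coe_inv_eq_conj, starRingEnd_apply, star_star, mul_comm]

theorem fourierInv_mul_diagonal_mul_fourier [DecidableEq (grid β S n)] (g : grid β S n → ℂ) :
    fourierInvOp β S n χ * matrixOp β S n (Matrix.diagonal g) * fourierOp β S n χ =
      matrixOp β S n (Matrix.of fun x y => ((residueCard K : ℂ) ^ (2 * n))⁻¹ *
        ∑ ξ : grid β S n, g ξ * (χ (((x : K) - y) * ξ) : ℂ)) := by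
  rw [fourierInvOp, fourierOp, matrixOp_mul, matrixOp_mul]
  congr 1
  ext x y
  rw [Matrix.mul_apply, Matrix.of_apply, Finset.mul_sum]
  refine Finset.sum_congr rfl fun ξ _ => ?_
  rw [Matrix.mul_diagonal, Matrix.of_apply, Matrix.of_apply,
    show ((x : K) - y) * ξ = (x : K) * ξ + -((ξ : K) * y) by ring, AddChar.map_add_eq_mul,
    Circle.coe_mul, two_mul, pow_add, mul_inv]
  ring

theorem fourierInv_mul_fourier (hβ : IsUniformizer β) (hS : IsResidueSystem S)
    (hχ : HasRankZero β χ) : fourierInvOp β S n χ * fourierOp β S n χ = 1 := by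
  classical
  have hq : (residueCard K : ℂ) ≠ 0 := Nat.cast_ne_zero.2 hS.residueCard_pos.ne'
  have h := fourierInv_mul_diagonal_mul_fourier (β := β) (S := S) (n := n) (χ := χ) fun _ => 1
  rw [Matrix.diagonal_one, matrixOp_one, mul_one] at h
  rw [h, ← matrixOp_one]
  congr 1
  ext x y
  simp only [one_mul, Matrix.of_apply]
  rw [Finset.sum_coe_sort (grid β S n) fun ξ => (χ (((x : K) - y) * ξ) : ℂ),
    sum_char_grid_sub hβ hS hχ x.2 y.2, Matrix.one_apply]
  simp only [Subtype.coe_inj]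
  split_ifs
  · field_simp
  · simp

/-- In finite dimension a one-sided inverse is two-sided. -/
theorem fourier_mul_fourierInv (hβ : IsUniformizer β) (hS : IsResidueSystem S)
    (hχ : HasRankZero β χ) : fourierOp β S n χ * fourierInvOp β S n χ = 1 := by
  have h := fourierInv_mul_fourier hβ hS hχ (n := n)
  rw [ContinuousLinearMap.ext_iff] at h ⊢
  have h1 : (fourierInvOp β S n χ).toLinearMap ∘ₗ (fourierOp β S n χ).toLinearMap = 1 :=
    LinearMap.ext h
  have h2 := mul_eq_one_comm.1 h1
  exact fun f => LinearMap.congr_fun h2 f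

theorem conjDiagonal_fourierOp [DecidableEq (grid β S n)]
    (h : star (fourierOp β S n χ) * fourierOp β S n χ = 1)
    (h' : fourierOp β S n χ * star (fourierOp β S n χ) = 1) (g : grid β S n → ℂ) :
    conjDiagonal (fourierOp β S n χ) h h' g =
      fourierInvOp β S n χ * matrixOp β S n (Matrix.diagonal g) * fourierOp β S n χ := by
  rw [← star_fourierOp, matrixOp_eq]
  rfl

/-- `F_n⁻¹` is also the adjoint of `F_n`, so `P_n` is unitarily diagonal with eigenvalues `|ξ|`. The
power and the exponential are taken on the eigenvalues. -/
theorem exp_smul_momentumOp_rpow (hβ : IsUniformizer β) (hS : IsResidueSystem S)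
    (hχ : HasRankZero β χ) {α : ℝ} (hα : 0 < α) (s : ℝ) :
    NormedSpace.exp (-(s : ℂ) • momentumOp β S n χ ^ α) =
      matrixOp β S n (Matrix.of fun x y =>
        ((residueCard K : ℂ) ^ n)⁻¹ * density β S n χ α s ((x : K) - y)) := by
  classical
  have h : star (fourierOp β S n χ) * fourierOp β S n χ = 1 := by
    rw [star_fourierOp, fourierInv_mul_fourier hβ hS hχ]
  have h' : fourierOp β S n χ * star (fourierOp β S n χ) = 1 := by
    rw [star_fourierOp, fourier_mul_fourierInv hβ hS hχ]
  have e : momentumOp β S n χ =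
      conjDiagonal (fourierOp β S n χ) h h' fun x => ((canonicalAbs (x : K) : ℝ) : ℂ) := by
    rw [conjDiagonal_fourierOp, momentumOp, mulOp]
  rw [e, conjDiagonal_rpow h h' (fun x => canonicalAbs_nonneg _) hα, ← map_smul,
    exp_conjDiagonal, conjDiagonal_fourierOp, fourierInv_mul_diagonal_mul_fourier]
  congr 1
  ext x y
  rw [Matrix.of_apply, Matrix.of_apply, density, ← mul_assoc, ← mul_inv, ← pow_add, ← two_mul]
  congr 1
  rw [← Finset.sum_coe_sort (grid β S n)]
  refine Finset.sum_congr rfl fun ξ _ => ?_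
  simp

theorem exp_smul_mulOp [DecidableEq (grid β S n)] (v : K → ℝ) (s : ℝ) :
    NormedSpace.exp (-(s : ℂ) • mulOp β S n v) =
      matrixOp β S n (Matrix.diagonal fun x => ((Real.exp (-s * v x) : ℝ) : ℂ)) := by
  have h : star (1 : GridL2 β S n →L[ℂ] GridL2 β S n) * 1 = 1 := by simp
  have h' : (1 : GridL2 β S n →L[ℂ] GridL2 β S n) * star 1 = 1 := by simp
  have key (g : grid β S n → ℂ) :
      conjDiagonal 1 h h' g = matrixOp β S n (Matrix.diagonal g) := by
    rw [matrixOp_eq]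
    change star (1 : GridL2 β S n →L[ℂ] GridL2 β S n) *
      Matrix.toEuclideanCLM (n := grid β S n) (𝕜 := ℂ) (Matrix.diagonal g) * 1 = _
    rw [star_one, one_mul, mul_one]
  have e : mulOp β S n v = conjDiagonal 1 h h' fun x => ((v x : ℝ) : ℂ) := by
    rw [key, mulOp]
    congr!
  rw [e, ← map_smul, exp_conjDiagonal, key]
  congr 2
  funext x
  simp

theorem canonicalAbs_gridRep_neg (hβ : IsUniformizer β) (hS : IsResidueSystem S) {ξ : K}
    (hξ : ξ ∈ grid β S n) : gridRep β S n (-gridRep β S n (-ξ)) = ξ ∧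
      canonicalAbs (gridRep β S n (-ξ)) = canonicalAbs ξ := by
  have hb := neg_mem_ball (mem_ball_of_mem_grid hβ hS hξ)
  have hb' := neg_mem_ball (mem_ball_of_mem_grid hβ hS (gridRep_mem hS (-ξ) (n := n) (β := β)))
  have h1 : gridRep β S n (-gridRep β S n (-ξ)) = ξ := by
    rw [gridRep_eq_iff hβ hS hb' hξ]
    convert sub_gridRep_mem hβ hS hb using 1
    ring
  refine ⟨h1, le_antisymm ?_ ?_⟩
  · refine canonicalAbs_le_of_valuation_le ((valuation_gridRep_le hβ hS hb).trans ?_)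
    rw [Valuation.map_neg]
  · refine canonicalAbs_le_of_valuation_le ?_
    have := valuation_gridRep_le hβ hS hb'
    rwa [h1, Valuation.map_neg] at this

/-- Substitute `ξ ↦ -ξ` in the group `X_n`, which preserves `|ξ|`. This reconciles the convolution
kernel `p(x - y)` of the semigroup with the transition density `p(y - x)` of the paths. -/
theorem density_neg (hβ : IsUniformizer β) (hS : IsResidueSystem S) (hχ : HasRankZero β χ)
    (α s : ℝ) {x : K} (hx : x ∈ ball β n) :
    density β S n χ α s (-x) = density β S n χ α s x := by
  unfold density
  congr 1
  refine Finset.sum_nbij' (fun ξ => gridRep β S n (-ξ)) (fun ξ => gridRep β S n (-ξ))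
    (fun ξ _ => gridRep_mem hS _) (fun ξ _ => gridRep_mem hS _)
    (fun ξ hξ => (canonicalAbs_gridRep_neg hβ hS hξ).1)
    (fun ξ hξ => (canonicalAbs_gridRep_neg hβ hS hξ).1) fun ξ hξ => ?_
  rw [(canonicalAbs_gridRep_neg hβ hS hξ).2,
    char_gridRep hβ hS hχ hx (neg_mem_ball (mem_ball_of_mem_grid hβ hS hξ)),
    neg_mul x, mul_neg x]

/-- The Trotter approximation of the semigroup of the finite Hamiltonian, in coordinates. -/
theorem tendsto_trotter_hamiltonian (hβ : IsUniformizer β) (hS : IsResidueSystem S)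
    (hχ : HasRankZero β χ) {α : ℝ} (hα : 0 < α) (v : K → ℝ) (t : ℝ) (f : GridL2 β S n)
    (x : grid β S n) [DecidableEq (grid β S n)] :
    Tendsto (fun m : ℕ => (((Matrix.of fun x y : grid β S n => ((residueCard K : ℂ) ^ n)⁻¹ *
        density β S n χ α (t / m) ((y : K) - x) * ((Real.exp (-(t / m) * v y) : ℝ) : ℂ)) ^ m).mulVec
          fun y => f y) x) atTop
      (𝓝 ((NormedSpace.exp (-(t : ℂ) • hamiltonian β S n χ α v) f) x)) := by
  have : Nonempty (grid β S n) := ⟨⟨0, zero_mem_grid hS⟩⟩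
  have h := tendsto_trotter (-(t : ℂ) • momentumOp β S n χ ^ α) (-(t : ℂ) • mulOp β S n v)
  have hsum : -(t : ℂ) • momentumOp β S n χ ^ α + -(t : ℂ) • mulOp β S n v =
      -(t : ℂ) • hamiltonian β S n χ α v := by
    rw [hamiltonian, smul_add]
  rw [hsum] at h
  have hc : Continuous fun T : GridL2 β S n →L[ℂ] GridL2 β S n => (T f) x := by
    have h1 : Continuous fun T : GridL2 β S n →L[ℂ] GridL2 β S n => T f := by fun_prop
    exact (PiLp.continuous_apply 2 _ x).comp h1
  refine ((hc.tendsto _).comp h).congr fun m => ?_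
  have e (A : GridL2 β S n →L[ℂ] GridL2 β S n) :
      (m : ℂ)⁻¹ • -(t : ℂ) • A = -((t / m : ℝ) : ℂ) • A := by
    rw [smul_smul]
    congr 1
    push_cast
    ring
  rw [Function.comp_apply, e, e, exp_smul_momentumOp_rpow hβ hS hχ hα, exp_smul_mulOp,
    matrixOp_mul, matrixOp_pow, matrixOp_apply]
  congr 3
  ext x y
  rw [Matrix.mul_diagonal, Matrix.of_apply, Matrix.of_apply]
  congr 2
  rw [← neg_sub, density_neg hβ hS hχ α _
    (sub_mem_ball (mem_ball_of_mem_grid hβ hS y.2) (mem_ball_of_mem_grid hβ hS x.2))]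

end Operators

/-! ### Matrix powers as sums over chains of points -/

section PathSum

theorem pow_mulVec_eq_sum {E : Type*} [Fintype E] [DecidableEq E] (M : Matrix E E ℂ) (f : E → ℂ)
    (m : ℕ) (x : E) : ((M ^ m).mulVec f) x = ∑ b : Fin m → E,
      (∏ i : Fin m, M ((Fin.cons x b : Fin (m + 1) → E) i.castSucc) (b i)) *
        f ((Fin.cons x b : Fin (m + 1) → E) (Fin.last m)) := by
  induction m generalizing x with
  | zero => simp
  | succ m ih =>
    rw [pow_succ', ← Matrix.mulVec_mulVec, Matrix.mulVec, dotProduct,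
      ← (Fin.consEquiv fun _ => E).sum_comp, Fintype.sum_prod_type]
    refine Finset.sum_congr rfl fun y _ => ?_
    rw [ih, Finset.mul_sum]
    refine Finset.sum_congr rfl fun b _ => ?_
    simp only [Fin.consEquiv_apply]
    rw [Fin.prod_univ_succ, ← Fin.succ_last, Fin.cons_succ]
    simp only [Fin.castSucc_zero, Fin.cons_zero, Fin.cons_succ, ← Fin.succ_castSucc]
    exact (mul_assoc _ _ _).symm

end PathSum

/-! ### Riemann sums of right continuous functions -/

section Riemann

/-- The right Riemann sums of a bounded right continuous function converge to its integral. -/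
theorem tendsto_riemann_sum {t : ℝ} (ht : 0 < t) {h : ℝ → ℝ} {C : ℝ} (hC : ∀ s, |h s| ≤ C)
    (hr : ∀ s ∈ Set.Ico 0 t, Tendsto h (𝓝[>] s) (𝓝 (h s))) :
    Tendsto (fun m : ℕ => ∑ i : Fin m, t / m * h (((i : ℕ) + 1) * (t / m))) atTop
      (𝓝 (∫ s in Set.Ico 0 t, h s)) := by
  set I : ℕ → ℕ → Set ℝ := fun m i => Set.Ico (i * (t / m)) ((i + 1) * (t / m)) with hI
  set F : ℕ → ℝ → ℝ := fun m s => ∑ i : Fin m, (I m i).indicator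
    (fun _ => h (((i : ℕ) + 1) * (t / m))) s with hF
  have hFs {m : ℕ} (hm : 0 < m) {s : ℝ} (hs : s ∈ Set.Ico 0 t) :
      -- The step function `F m` takes at `s` the value of `h` at the right end of the interval
      -- containing `s`; that end lies strictly to the right of `s`, so right continuity applies.
      F m s = h (((⌊s / (t / m)⌋₊ : ℕ) + 1) * (t / m)) := by
    have hm' : (0 : ℝ) < m := Nat.cast_pos.2 hm
    have hd : 0 < t / m := div_pos ht hm'
    have h0 : 0 ≤ s / (t / m) := div_nonneg hs.1 hd.le
    have hk : ⌊s / (t / m)⌋₊ < m := by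
      rw [Nat.floor_lt h0, div_lt_iff₀ hd]
      have : (m : ℝ) * (t / m) = t := by field_simp
      rw [this]
      exact hs.2
    have hmem (i : ℕ) : s ∈ I m i ↔ ⌊s / (t / m)⌋₊ = i := by
      rw [Nat.floor_eq_iff h0, le_div_iff₀ hd, div_lt_iff₀ hd]
      exact Iff.rfl
    rw [hF]
    change ∑ i : Fin m, _ = _
    rw [Finset.sum_eq_single ⟨⌊s / (t / m)⌋₊, hk⟩]
    · rw [Set.indicator_of_mem ((hmem _).2 rfl)]
    · intro i _ hi
      refine Set.indicator_of_notMem (fun hs' => hi ?_) _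
      exact Fin.ext ((hmem i).1 hs').symm
    · simp
  have hint (m : ℕ) (hm : 0 < m) : ∫ s in Set.Ico 0 t, F m s =
      ∑ i : Fin m, t / m * h (((i : ℕ) + 1) * (t / m)) := by
    have hm' : (0 : ℝ) < m := Nat.cast_pos.2 hm
    have hd : 0 < t / m := div_pos ht hm'
    rw [hF, integral_finsetSum]
    · refine Finset.sum_congr rfl fun i _ => ?_
      rw [setIntegral_indicator measurableSet_Ico, setIntegral_const, smul_eq_mul]
      congr 1
      have hsub : I m i ⊆ Set.Ico 0 t := by
        refine Set.Ico_subset_Ico (by positivity) ?_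
        have h1 : ((i : ℕ) + 1 : ℝ) ≤ m := by exact_mod_cast i.2
        calc ((i : ℕ) + 1 : ℝ) * (t / m) ≤ m * (t / m) := by gcongr
          _ = t := by field_simp
      rw [Set.inter_eq_right.2 hsub, hI, Real.volume_real_Ico_of_le (by gcongr; linarith)]
      ring
    · exact fun i _ => (integrable_const _).indicator measurableSet_Ico
  have hlim : Tendsto (fun m => ∫ s in Set.Ico 0 t, F m s) atTop
      (𝓝 (∫ s in Set.Ico 0 t, h s)) := by
    refine tendsto_integral_of_dominated_convergence (fun _ => C) ?_ (integrable_const _) ?_ ?_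
    · intro m
      refine Measurable.aestronglyMeasurable ?_
      exact Finset.measurable_fun_sum _ fun i _ => measurable_const.indicator measurableSet_Ico
    · intro m
      rcases Nat.eq_zero_or_pos m with rfl | hm
      · refine Eventually.of_forall fun s => ?_
        simpa [hF] using (abs_nonneg _).trans (hC 0)
      · filter_upwards [ae_restrict_mem measurableSet_Ico] with s hs
        rw [hFs hm hs]
        exact hC _
    · filter_upwards [ae_restrict_mem measurableSet_Ico] with s hs
      have hr' : Tendsto (fun m : ℕ => ((⌊s / (t / m)⌋₊ : ℕ) + 1 : ℝ) * (t / m)) atTop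
          (𝓝[>] s) := by
        have hlow : ∀ᶠ m : ℕ in atTop, s < ((⌊s / (t / m)⌋₊ : ℕ) + 1 : ℝ) * (t / m) := by
          filter_upwards [eventually_gt_atTop 0] with m hm
          have hd : 0 < t / m := div_pos ht (Nat.cast_pos.2 hm)
          rw [← div_lt_iff₀ hd]
          exact Nat.lt_floor_add_one _
        refine tendsto_nhdsWithin_iff.2 ⟨?_, hlow⟩
        have hup : Tendsto (fun m : ℕ => s + t / m) atTop (𝓝 (s + 0)) :=
          tendsto_const_nhds.add (tendsto_const_div_atTop_nhds_zero_nat t)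
        rw [add_zero] at hup
        refine tendsto_of_tendsto_of_tendsto_of_le_of_le' tendsto_const_nhds hup
          (hlow.mono fun m hm => hm.le) ?_
        filter_upwards [eventually_gt_atTop 0] with m hm
        have hd : 0 < t / m := div_pos ht (Nat.cast_pos.2 hm)
        have := Nat.floor_le (div_nonneg hs.1 hd.le)
        rw [le_div_iff₀ hd] at this
        linarith
      refine ((hr s hs).comp hr').congr' ?_
      filter_upwards [eventually_gt_atTop 0] with m hm
      rw [hFs hm hs]
      rfl
  refine hlim.congr' ?_
  filter_upwards [eventually_gt_atTop 0] with m hm using hint m hm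

end Riemann

/-! ### The discretised potential along a path -/

section Paths

variable {K : Type*} [Field K] [ValuativeRel K] [TopologicalSpace K]
  [IsNonarchimedeanLocalField K] {β : K} {S : Finset K} {n : ℕ} {χ : AddChar K Circle}

/-- The balls are clopen, so their indicators are continuous, and `v_n ∘ ω` inherits right
continuity from `ω`. -/
theorem continuous_discretize (v : K → ℝ) : Continuous (discretize β S n v) := by
  unfold discretize
  refine continuous_finsetSum _ fun y _ => ?_
  have hc : IsClopen {w : K | w - y ∈ ball β (-(n : ℤ))} :=
    (isClopen_ball (β := β) (-(n : ℤ))).preimage (continuous_id.sub continuous_const)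
  exact continuous_const.indicator fun x hx => by simp [hc.frontier_eq] at hx

theorem discretize_of_mem_grid (hβ : IsUniformizer β) (hS : IsResidueSystem S) (v : K → ℝ) {x : K}
    (hx : x ∈ grid β S n) : discretize β S n v x = v x := by
  rw [discretize, Finset.sum_eq_single x]
  · exact Set.indicator_of_mem (by simpa using zero_mem_ball _) _
  · intro y hy hne
    refine Set.indicator_of_notMem (fun h => hne ?_) _
    exact (grid_eq_of_sub_mem_ball hβ hS hx hy h).symm
  · exact fun h => absurd hx h

theorem discretize_nonneg {v : K → ℝ} (hv : ∀ x, 0 ≤ v x) (x : K) :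
    0 ≤ discretize β S n v x :=
  Finset.sum_nonneg fun y _ => Set.indicator_nonneg (fun _ _ => hv y) x

theorem discretize_le {v : K → ℝ} (hv : ∀ x, 0 ≤ v x) (x : K) :
    discretize β S n v x ≤ ∑ y ∈ grid β S n, v y :=
  Finset.sum_le_sum fun y _ => Set.indicator_apply_le' (fun _ => le_rfl) fun _ => hv y

/-- The time `(i+1) t / m` in `[0,t]`. -/
def gridTime {t : ℝ} (ht : 0 ≤ t) {m : ℕ} (i : Fin m) : Set.Icc (0 : ℝ) t :=
  ⟨((i : ℕ) + 1) * (t / m), by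
    have hm : 0 < m := i.pos
    have hm' : (0 : ℝ) < m := Nat.cast_pos.2 hm
    refine ⟨by positivity, ?_⟩
    have h1 : ((i : ℕ) + 1 : ℝ) ≤ m := by exact_mod_cast i.2
    calc ((i : ℕ) + 1 : ℝ) * (t / m) ≤ m * (t / m) := by gcongr
      _ = t := by field_simp⟩

theorem tendsto_riemann_sum_path {v : K → ℝ} (hv : ∀ x, 0 ≤ v x) {t : ℝ} (ht : 0 < t)
    (ω : skorokhod K t) :
    Tendsto (fun m : ℕ => ∑ i : Fin m, t / m * discretize β S n v (ω.1 (gridTime ht.le i))) atTop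
      (𝓝 (∫ s : Set.Icc (0 : ℝ) t, discretize β S n v (ω.1 s) ∂(volume.comap Subtype.val))) := by
  set h : ℝ → ℝ := fun s => discretize β S n v (ω.1 (Set.projIcc 0 t ht.le s)) with hh
  have e : ∫ s : Set.Icc (0 : ℝ) t, discretize β S n v (ω.1 s) ∂(volume.comap Subtype.val) =
      ∫ s in Set.Ico 0 t, h s := by
    rw [← integral_Icc_eq_integral_Ico, ← integral_subtype_comap measurableSet_Icc]
    simp [hh]
  rw [e]
  have hb (s : ℝ) : |h s| ≤ ∑ y ∈ grid β S n, v y := by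
    rw [abs_of_nonneg (discretize_nonneg hv _)]
    exact discretize_le hv _
  refine (tendsto_riemann_sum ht hb fun s hs => ?_).congr fun m => ?_
  · have hs' : s ∈ Set.Icc 0 t := ⟨hs.1, hs.2.le⟩
    have h1 : Tendsto (Set.projIcc 0 t ht.le) (𝓝[>] s) (𝓝[>] (⟨s, hs'⟩ : Set.Icc (0 : ℝ) t)) := by
      refine tendsto_nhdsWithin_iff.2 ⟨?_, ?_⟩
      · have := (continuous_projIcc (h := ht.le)).tendsto s
        rw [Set.projIcc_of_mem ht.le hs'] at this
        exact this.mono_left nhdsWithin_le_nhds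
      · have : ∀ᶠ r in 𝓝[>] s, r ∈ Set.Ioo s t := Ioo_mem_nhdsGT hs.2
        filter_upwards [this] with r hr
        rw [Set.projIcc_of_mem ht.le ⟨hs.1.trans hr.1.le, hr.2.le⟩]
        exact hr.1
    have h2 := (ω.2.1 ⟨s, hs'⟩ hs.2).comp h1
    have h3 := ((continuous_discretize (β := β) (S := S) (n := n) v).tendsto _).comp h2
    rw [hh]
    simp only [Set.projIcc_of_mem ht.le hs']
    exact h3
  · refine Finset.sum_congr rfl fun i _ => ?_
    rw [hh]
    simp only
    congr 3
    exact congrArg ω.1 (Set.projIcc_of_mem ht.le (gridTime ht.le i).2)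

theorem strictMono_gridTime {t : ℝ} (ht : 0 < t) {m : ℕ} :
    StrictMono (gridTime ht.le : Fin m → Set.Icc (0 : ℝ) t) := by
  intro i j hij
  have hm' : (0 : ℝ) < m := Nat.cast_pos.2 i.pos
  refine Subtype.coe_lt_coe.1 ?_
  change ((i : ℕ) + 1 : ℝ) * (t / m) < ((j : ℕ) + 1) * (t / m)
  have : ((i : ℕ) : ℝ) < (j : ℕ) := by exact_mod_cast hij
  have hd : 0 < t / m := div_pos ht hm'
  gcongr

theorem gridTime_sub {t : ℝ} (ht : 0 ≤ t) {m : ℕ} (i : Fin m) :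
    ((gridTime ht i : ℝ) - (Fin.cons 0 (fun j => (gridTime ht j : ℝ)) : Fin (m + 1) → ℝ)
      i.castSucc) = t / m := by
  obtain ⟨m, rfl⟩ : ∃ k, m = k + 1 := ⟨m - 1, by have := i.pos; omega⟩
  refine Fin.cases ?_ (fun j => ?_) i
  · simp [gridTime]
  · rw [← Fin.succ_castSucc, Fin.cons_succ]
    simp [gridTime]
    ring

end Paths

/-! ### The Feynman–Kac formula and the bridge kernel -/

section FeynmanKac

variable {K : Type*} [Field K] [ValuativeRel K] [TopologicalSpace K]
  [IsNonarchimedeanLocalField K] {β : K} {S : Finset K} {n : ℕ} {χ : AddChar K Circle}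
  [MeasurableSpace K] [BorelSpace K]

theorem IsPathLaw.real_singleton {α t : ℝ} {a : K} {P : Measure (skorokhod K t)}
    (hP : IsPathLaw β S n χ α t a P) {N : ℕ} {τ : Fin N → Set.Icc (0 : ℝ) t} (hτ : StrictMono τ)
    {b : Fin N → K} (hb : ∀ i, b i ∈ grid β S n) :
    ((P.real {ω | ∀ i, ω.1 (τ i) = b i} : ℝ) : ℂ) =
      (∏ i : Fin N, density β S n χ α
        ((τ i : ℝ) - (Fin.cons 0 (fun j => (τ j : ℝ)) : Fin (N + 1) → ℝ) i.castSucc)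
        (b i - (Fin.cons a b : Fin (N + 1) → K) i.castSucc)) *
      ((residueCard K : ℂ) ^ (n * N))⁻¹ := by
  classical
  have h := hP.cylinder N τ hτ (fun i => {b i}) fun i => measurableSet_singleton _
  simp only [Set.mem_singleton_iff] at h
  rw [h, Finset.sum_eq_single b]
  · intro c hc hne
    refine absurd (funext fun i => ?_) hne
    have := Fintype.mem_piFinset.1 hc i
    exact (Finset.mem_filter.1 this).2
  · intro hb'
    refine absurd (Fintype.mem_piFinset.2 fun i => ?_) hb'
    exact Finset.mem_filter.2 ⟨hb i, rfl⟩

/-- The cylinder formula sees only the points of `J i ∩ X_n`, so it gives the same value for `J i =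
X_n` and for `J i = K`. -/
theorem IsPathLaw.ae_mem_grid {α t : ℝ} {a : K} {P : Measure (skorokhod K t)}
    (hP : IsPathLaw β S n χ α t a P) {N : ℕ} {τ : Fin N → Set.Icc (0 : ℝ) t}
    (hτ : StrictMono τ) : ∀ᵐ ω ∂P, ∀ i, ω.1 (τ i) ∈ grid β S n := by
  have := hP.isProbabilityMeasure
  have hm : MeasurableSet {ω : skorokhod K t | ∀ i, ω.1 (τ i) ∈ (grid β S n : Set K)} :=
    measurableSet_cylinder τ fun _ => (grid β S n).measurableSet
  have h1 := hP.cylinder N τ hτ (fun _ => (grid β S n : Set K))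
    fun _ => (grid β S n).measurableSet
  have h2 := hP.cylinder N τ hτ (fun _ => Set.univ) fun _ => MeasurableSet.univ
  have h3 : P.real {ω | ∀ i, ω.1 (τ i) ∈ (grid β S n : Set K)} = 1 := by
    have : P.real {ω | ∀ i, ω.1 (τ i) ∈ (Set.univ : Set K)} = 1 := by simp
    rw [← this]
    refine Complex.ofReal_injective ?_
    rw [h1, h2]
    refine Finset.sum_congr (congrArg Fintype.piFinset (funext fun i => ?_)) fun _ _ => rfl
    ext z
    simp
  have h4 : P {ω | ∀ i, ω.1 (τ i) ∈ (grid β S n : Set K)} = 1 :=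
    (ENNReal.toReal_eq_one_iff _).1 h3
  exact (mem_ae_iff_prob_eq_one hm).2 h4

theorem IsPathLaw.integral_eq_sum {α t : ℝ} {a : K} {P : Measure (skorokhod K t)}
    (hP : IsPathLaw β S n χ α t a P) {N : ℕ} {τ : Fin N → Set.Icc (0 : ℝ) t} (hτ : StrictMono τ)
    (G : (Fin N → K) → ℂ) :
    ∫ ω, G (fun i => ω.1 (τ i)) ∂P = ∑ b : Fin N → grid β S n,
      G (fun i => b i) * ((∏ i : Fin N, density β S n χ α
        ((τ i : ℝ) - (Fin.cons 0 (fun j => (τ j : ℝ)) : Fin (N + 1) → ℝ) i.castSucc)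
        (b i - (Fin.cons a (fun i => (b i : K)) : Fin (N + 1) → K) i.castSucc)) *
      ((residueCard K : ℂ) ^ (n * N))⁻¹) := by
  classical
  have := hP.isProbabilityMeasure
  set A : (Fin N → grid β S n) → Set (skorokhod K t) := fun b => {ω | ∀ i, ω.1 (τ i) = b i}
    with hA
  have hAm (b : Fin N → grid β S n) : MeasurableSet (A b) :=
    measurableSet_cylinder τ (J := fun i => {(b i : K)}) fun _ => measurableSet_singleton _
  have h1 : (fun ω : skorokhod K t => G fun i => ω.1 (τ i)) =ᵐ[P] fun ω =>
      ∑ b : Fin N → grid β S n, (A b).indicator (fun _ => G fun i => b i) ω := by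
    filter_upwards [hP.ae_mem_grid hτ] with ω hω
    rw [Finset.sum_eq_single fun i => ⟨ω.1 (τ i), hω i⟩]
    · rw [Set.indicator_of_mem]
      exact fun i => rfl
    · intro b _ hb
      refine Set.indicator_of_notMem (fun h => hb (funext fun i => Subtype.ext (h i).symm)) _
    · simp
  rw [integral_congr_ae h1, integral_finsetSum _ fun b _ =>
    (integrable_const _).indicator (hAm b)]
  refine Finset.sum_congr rfl fun b _ => ?_
  rw [integral_indicator (hAm b), setIntegral_const, ← hP.real_singleton hτ fun i => (b i).2,
    mul_comm, Complex.real_smul]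

/-- The extension of a function on `X_n` to `K` by zero. -/
def extendZero (f : grid β S n → ℂ) (z : K) : ℂ :=
  ∑ y : grid β S n, ({(y : K)} : Set K).indicator (fun _ => f y) z

theorem extendZero_coe (f : grid β S n → ℂ) (y : grid β S n) : extendZero f (y : K) = f y := by
  rw [extendZero, Finset.sum_eq_single y]
  · simp
  · intro z _ hz
    refine Set.indicator_of_notMem (fun h => hz (Subtype.ext ?_)) _
    exact h.symm
  · simp

theorem measurable_extendZero (f : grid β S n → ℂ) : Measurable (extendZero f) :=
  Finset.measurable_fun_sum _ fun _ _ => measurable_const.indicator (measurableSet_singleton _)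

theorem norm_extendZero_le (f : grid β S n → ℂ) (z : K) :
    ‖extendZero f z‖ ≤ ∑ y : grid β S n, ‖f y‖ :=
  (norm_sum_le _ _).trans (Finset.sum_le_sum fun _ _ => norm_indicator_le_norm_self _ _)

theorem measurable_eval {t : ℝ} (s : Set.Icc (0 : ℝ) t) :
    Measurable fun ω : skorokhod K t => ω.1 s :=
  (measurable_pi_apply s).comp measurable_subtype_coe

/-- The Feynman–Kac weight of a path. -/
def pathWeight (β : K) (S : Finset K) (n : ℕ) (v : K → ℝ) {t : ℝ} (ω : skorokhod K t) : ℝ :=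
  Real.exp (-∫ s : Set.Icc (0 : ℝ) t, discretize β S n v (ω.1 s) ∂(volume.comap Subtype.val))

/-- The σ-algebra knows only evaluations; the time integral is measurable as a pointwise limit of
Riemann sums, each involving finitely many of them. -/
theorem measurable_pathWeight {v : K → ℝ} (hv : ∀ x, 0 ≤ v x) {t : ℝ} (ht : 0 < t) :
    Measurable fun ω : skorokhod K t => pathWeight β S n v ω := by
  refine Real.measurable_exp.comp (Measurable.neg ?_)
  refine measurable_of_tendsto_metrizable (f := fun (m : ℕ) (ω : skorokhod K t) =>
    ∑ i : Fin m, t / m * discretize β S n v (ω.1 (gridTime ht.le i))) (fun m => ?_)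
    (tendsto_pi_nhds.2 fun ω => tendsto_riemann_sum_path hv ht ω)
  refine Finset.measurable_fun_sum _ fun i _ => measurable_const.mul ?_
  exact (continuous_discretize v).measurable.comp (measurable_eval _)

theorem pathWeight_le_one {v : K → ℝ} (hv : ∀ x, 0 ≤ v x) {t : ℝ} (ω : skorokhod K t) :
    pathWeight β S n v ω ≤ 1 := by
  rw [pathWeight, Real.exp_le_one_iff, neg_nonpos]
  exact integral_nonneg fun s => discretize_nonneg hv _

/-- At the equidistant times `t/m, 2t/m, …, t` all transition densities have the same step `t/m`, so
the expectation is exactly the chain expansion of a matrix power. Right endpoints match the Trotter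
order, in which each transition is followed by the potential at its target. -/
theorem integral_trotter (hβ : IsUniformizer β) (hS : IsResidueSystem S) {α t : ℝ} (ht : 0 < t)
    (v : K → ℝ) {x : grid β S n} {P : Measure (skorokhod K t)}
    (hP : IsPathLaw β S n χ α t x P) (f : grid β S n → ℂ) {m : ℕ} (hm : 0 < m)
    [DecidableEq (grid β S n)] :
    ∫ ω, ((Real.exp (-∑ i : Fin m, t / m * discretize β S n v (ω.1 (gridTime ht.le i))) : ℝ) : ℂ) *
        extendZero f (ω.1 ⟨t, ht.le, le_rfl⟩) ∂P =
      ((Matrix.of fun x y : grid β S n => ((residueCard K : ℂ) ^ n)⁻¹ *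
        density β S n χ α (t / m) ((y : K) - x) * ((Real.exp (-(t / m) * v y) : ℝ) : ℂ)) ^ m).mulVec
          f x := by
  obtain ⟨k, rfl⟩ : ∃ k, m = k + 1 := ⟨m - 1, by omega⟩
  have hlast : (⟨t, ht.le, le_rfl⟩ : Set.Icc (0 : ℝ) t) = gridTime ht.le (Fin.last k) := by
    refine Subtype.ext ?_
    simp only [gridTime, Fin.val_last]
    push_cast
    field_simp
  rw [hlast, hP.integral_eq_sum (strictMono_gridTime ht) fun b =>
    ((Real.exp (-∑ i, t / (k + 1 : ℕ) * discretize β S n v (b i)) : ℝ) : ℂ) *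
      extendZero f (b (Fin.last k)), pow_mulVec_eq_sum]
  refine Finset.sum_congr rfl fun b _ => ?_
  have hcons (j : Fin (k + 1 + 1)) : (Fin.cons (x : K) (fun i => (b i : K)) : Fin (k + 1 + 1) → K) j
      = ((Fin.cons x b : Fin (k + 1 + 1) → grid β S n) j : K) := by
    refine Fin.cases ?_ (fun i => ?_) j <;> simp
  simp only [gridTime_sub, hcons, Matrix.of_apply, Finset.prod_mul_distrib, Finset.prod_const,
    Finset.card_univ, Fintype.card_fin, extendZero_coe]
  rw [← Fin.succ_last, Fin.cons_succ, ← Complex.ofReal_prod, ← Real.exp_sum, inv_pow, ← pow_mul]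
  have : ∑ i : Fin (k + 1), -(t / (k + 1 : ℕ)) * v (b i) =
      -∑ i : Fin (k + 1), t / (k + 1 : ℕ) * discretize β S n v (b i) := by
    rw [← Finset.sum_neg_distrib]
    refine Finset.sum_congr rfl fun i _ => ?_
    rw [discretize_of_mem_grid hβ hS v (b i).2, neg_mul]
  rw [this]
  ring

/-- The Feynman–Kac formula for the semigroup of the finite Hamiltonian. -/
theorem exp_hamiltonian_eq_integral (hβ : IsUniformizer β) (hS : IsResidueSystem S)
    (hχ : HasRankZero β χ) {α : ℝ} (hα : 0 < α) {t : ℝ} (ht : 0 < t) {v : K → ℝ}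
    (hv : ∀ x, 0 ≤ v x) {x : grid β S n} {P : Measure (skorokhod K t)}
    (hP : IsPathLaw β S n χ α t x P) (f : GridL2 β S n) :
    (NormedSpace.exp (-(t : ℂ) • hamiltonian β S n χ α v) f) x =
      ∫ ω, (pathWeight β S n v ω : ℂ) *
        extendZero (fun y => f y) (ω.1 ⟨t, ht.le, le_rfl⟩) ∂P := by
  classical
  have := hP.isProbabilityMeasure
  refine tendsto_nhds_unique (tendsto_trotter_hamiltonian hβ hS hχ hα v t f x) ?_
  have hlim : Tendsto (fun m : ℕ => ∫ ω,
      ((Real.exp (-∑ i : Fin m, t / m * discretize β S n v (ω.1 (gridTime ht.le i))) : ℝ) : ℂ) *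
        extendZero (fun y => f y) (ω.1 ⟨t, ht.le, le_rfl⟩) ∂P) atTop
      (𝓝 (∫ ω, (pathWeight β S n v ω : ℂ) *
        extendZero (fun y => f y) (ω.1 ⟨t, ht.le, le_rfl⟩) ∂P)) := by
    refine tendsto_integral_of_dominated_convergence (fun _ => ∑ y : grid β S n, ‖f y‖) ?_
      (integrable_const _) ?_ ?_
    · intro m
      refine Measurable.aestronglyMeasurable (Measurable.mul ?_
        ((measurable_extendZero _).comp (measurable_eval _)))
      refine Complex.measurable_ofReal.comp (Real.measurable_exp.comp (Measurable.neg ?_))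
      refine Finset.measurable_fun_sum _ fun i _ => measurable_const.mul ?_
      exact (continuous_discretize v).measurable.comp (measurable_eval _)
    · refine fun m => Eventually.of_forall fun ω => ?_
      rw [norm_mul, Complex.norm_real, Real.norm_eq_abs, Real.abs_exp]
      refine (mul_le_of_le_one_left (norm_nonneg _) ?_).trans (norm_extendZero_le _ _)
      rw [Real.exp_le_one_iff, neg_nonpos]
      exact Finset.sum_nonneg fun i _ => mul_nonneg (by positivity) (discretize_nonneg hv _)
    · refine Eventually.of_forall fun ω => Tendsto.mul_const _ ?_
      refine (Complex.continuous_ofReal.tendsto _).comp ?_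
      exact (Real.continuous_exp.tendsto _).comp (tendsto_riemann_sum_path hv ht ω).neg
  refine hlim.congr' ?_
  filter_upwards [eventually_gt_atTop 0] with m hm
  exact integral_trotter hβ hS ht v hP (fun y => f y) hm

/-- The factor `q^{-n} p_{t,n}(y - x)` is the probability of `ω(t) = y`, by which the bridge measure
was divided. -/
theorem kernel_eq_setIntegral (hβ : IsUniformizer β) (hS : IsResidueSystem S)
    (hχ : HasRankZero β χ) {α : ℝ} (hα : 0 < α) {t : ℝ} (ht : 0 < t) (v : K → ℝ)
    (x y : grid β S n) :
    ((residueCard K : ℂ) ^ n)⁻¹ * kernel β S n χ α t v x y =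
      ((∫ ω in {ω : skorokhod K t | ω.1 ⟨t, ht.le, le_rfl⟩ = y}, pathWeight β S n v ω
        ∂(pathMeasure β S n χ α t x) : ℝ) : ℂ) := by
  have hP := isPathLaw_pathMeasure hβ hS hχ hα ht.le x.2
  have := hP.isProbabilityMeasure
  set P := pathMeasure β S n χ α t x
  have hset : {ω : skorokhod K t | ∀ s : Set.Icc (0 : ℝ) t, (s : ℝ) = t → ω.1 s = y} =
      {ω : skorokhod K t | ω.1 ⟨t, ht.le, le_rfl⟩ = y} := by
    ext ω
    refine ⟨fun h => h _ rfl, fun h s hs => ?_⟩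
    rw [← show ω.1 ⟨t, ht.le, le_rfl⟩ = y from h]
    refine congrArg ω.1 ?_
    exact Subtype.ext (show (s : ℝ) = t from hs)
  set A := {ω : skorokhod K t | ω.1 ⟨t, ht.le, le_rfl⟩ = y} with hA
  have hd : ((P.real A : ℝ) : ℂ) = density β S n χ α t (y - x) * ((residueCard K : ℂ) ^ n)⁻¹ := by
    have := hP.real_singleton (N := 1) (τ := fun _ => ⟨t, ht.le, le_rfl⟩)
      (fun i j h => absurd h (by simp [Subsingleton.elim i j])) (b := fun _ => (y : K))
      fun _ => y.2
    simpa [hA] using this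
  have hk : kernel β S n χ α t v x y = (((P A)⁻¹.toReal * ∫ ω in A, pathWeight β S n v ω ∂P : ℝ) : ℂ)
      * density β S n χ α t (y - x) := by
    rw [kernel, bridgeMeasure, hset, ProbabilityTheory.cond, integral_smul_measure, smul_eq_mul]
    rfl
  rw [hk, mul_comm, mul_assoc, ← hd, ENNReal.toReal_inv, ← Complex.ofReal_mul]
  congr 1
  change (P.real A)⁻¹ * _ * P.real A = _
  -- If the endpoint has probability zero, nothing can be cancelled, but both sides vanish.
  by_cases h0 : P.real A = 0
  · rw [h0, mul_zero, setIntegral_measure_zero]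
    exact (measureReal_eq_zero_iff).1 h0
  · field_simp

theorem exp_hamiltonian_eq_sum_kernel (hβ : IsUniformizer β) (hS : IsResidueSystem S)
    (hχ : HasRankZero β χ) {α : ℝ} (hα : 0 < α) {t : ℝ} (ht : 0 < t) {v : K → ℝ}
    (hv : ∀ x, 0 ≤ v x) (f : GridL2 β S n) (x : grid β S n) :
    (NormedSpace.exp (-(t : ℂ) • hamiltonian β S n χ α v) f) x =
      ((residueCard K : ℂ) ^ n)⁻¹ * ∑ y : grid β S n, kernel β S n χ α t v x y * f y := by
  have hP := isPathLaw_pathMeasure hβ hS hχ hα ht.le x.2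
  have := hP.isProbabilityMeasure
  rw [exp_hamiltonian_eq_integral hβ hS hχ hα ht hv hP f, Finset.mul_sum]
  set P := pathMeasure β S n χ α t x with hPdef
  set A : grid β S n → Set (skorokhod K t) := fun y => {ω | ω.1 ⟨t, ht.le, le_rfl⟩ = y} with hA
  have hAm (y : grid β S n) : MeasurableSet (A y) :=
    measurable_eval _ (measurableSet_singleton (y : K))
  have hW : Integrable (fun ω : skorokhod K t => (pathWeight β S n v ω : ℂ)) P := by
    refine Integrable.of_bound
      (Complex.measurable_ofReal.comp (measurable_pathWeight hv ht)).aestronglyMeasurable 1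
      (Eventually.of_forall fun ω => ?_)
    rw [Complex.norm_real, Real.norm_eq_abs, abs_of_nonneg (by exact Real.exp_nonneg _)]
    exact pathWeight_le_one hv ω
  have e (ω : skorokhod K t) : (pathWeight β S n v ω : ℂ) *
      extendZero (fun y => f y) (ω.1 ⟨t, ht.le, le_rfl⟩) =
      ∑ y : grid β S n, (A y).indicator (fun ω => (pathWeight β S n v ω : ℂ) * f y) ω := by
    rw [extendZero, Finset.mul_sum]
    refine Finset.sum_congr rfl fun y _ => ?_
    by_cases h : ω.1 ⟨t, ht.le, le_rfl⟩ ∈ ({(y : K)} : Set K)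
    · rw [Set.indicator_of_mem h, Set.indicator_of_mem (show ω ∈ A y from h)]
    · rw [Set.indicator_of_notMem h, Set.indicator_of_notMem (show ω ∉ A y from h), mul_zero]
  simp only [e]
  rw [integral_finsetSum _ fun y _ => (hW.mul_const _).indicator (hAm y)]
  refine Finset.sum_congr rfl fun y _ => ?_
  rw [integral_indicator (hAm y), integral_mul_const, integral_complex_ofReal, ← mul_assoc,
    kernel_eq_setIntegral hβ hS hχ hα ht v x y]

theorem integral_gridMeasure (F : grid β S n → ℂ) :
    ∫ y, F y ∂(gridMeasure β S n) = ((residueCard K : ℂ) ^ n)⁻¹ * ∑ y : grid β S n, F y := by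
  rw [gridMeasure, integral_smul_measure, integral_count]
  simp

end FeynmanKac

end FiniteFK

end

theorem mainTheorem3 {K : Type*} [Field K] [ValuativeRel K] [TopologicalSpace K]
    [IsNonarchimedeanLocalField K] [MeasurableSpace K] [BorelSpace K]
    (β : K) (hβ : FiniteFK.IsUniformizer β)
    (S : Finset K) (hS : FiniteFK.IsResidueSystem S)
    (χ : AddChar K Circle) (hχc : Continuous χ) (hχ : FiniteFK.HasRankZero β χ)
    (v : K → ℝ) (hv0 : ∀ x, 0 ≤ v x) (hvc : Continuous v)
    (hv : Filter.Tendsto v (Filter.comap FiniteFK.canonicalAbs Filter.atTop) Filter.atTop)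
    (α : ℝ) (hα : 0 < α) (n : ℕ) (hn : 0 < n) (t : ℝ) (ht : 0 < t) :
    (∀ a ∈ FiniteFK.grid β S n, ∃! P : MeasureTheory.Measure (FiniteFK.skorokhod K t),
      FiniteFK.IsPathLaw β S n χ α t a P) ∧
    ∀ (f : FiniteFK.GridL2 β S n) (x : FiniteFK.grid β S n),
      (NormedSpace.exp (-(t : ℂ) • FiniteFK.hamiltonian β S n χ α v) f) x =
          ∫ y : FiniteFK.grid β S n, FiniteFK.kernel β S n χ α t v x y * f y
            ∂(FiniteFK.gridMeasure β S n) ∧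
      (NormedSpace.exp (-(t : ℂ) • FiniteFK.hamiltonian β S n χ α v) f) x =
          ((FiniteFK.residueCard K : ℂ) ^ n)⁻¹ *
            ∑ y : FiniteFK.grid β S n, FiniteFK.kernel β S n χ α t v x y * f y := by
  refine ⟨fun a ha => FiniteFK.existsUnique_isPathLaw hβ hS hχ hα ht.le ha, fun f x => ?_⟩
  have h := FiniteFK.exp_hamiltonian_eq_sum_kernel hβ hS hχ hα ht hv0 f x
  exact ⟨h.trans (FiniteFK.integral_gridMeasure _).symm, h⟩
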